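/- Consider red/blue colorings of the edges of the complete graph $K_N$. Such a coloring is called $\theta$-quasirandom if $\left|e_B(X,Y)-\tfrac12|X||Y|\right|\le \theta N^2$ for all disjoint $X,Y\subseteq V(K_N)$, where $e_B(X,Y)$ is the number of blue edges between $X$ and $Y$. An extension of a monochromatic $K_k$ with vertex set $Q$ to a monochromatic $K_{k+1}$ is a vertex $v\notin Q$ such that $Q\cup\{v\}$ spans a monochromatic $K_{k+1}$. **Theorem.** For any $k\ge 2$ and any $0<\theta<\tfrac12$, there is some $c_1=c_1(\theta,k)>0$ such that, for all sufficiently large $N$ (depending only on $\theta$ and $k$), every red/blue edge coloring of $K_N$ that is not $\theta$-quasirandom contains at least $c_1N^k$ monochromatic $K_k$, each of which has at least $(2^{-k}+c_1)N$ extensions to a monochromatic $K_{k+1}$. -/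

import Mathlib

/-- A red/blue edge coloring of the complete graph `K_N` on the vertex set `Fin N`
(an arbitrary function from the edges to the colors `0` = red and `1` = blue). -/
abbrev Coloring (N : ℕ) : Type := SimpleGraph.TopEdgeLabeling (Fin N) (Fin 2)

namespace Coloring

variable {N : ℕ}

/-- The graph of blue edges. -/
abbrev blue (C : Coloring N) : SimpleGraph (Fin N) := C.labelGraph 1

/-- The coloring is `θ`-quasirandom: for all disjoint `X`, `Y`, the number of blue edges between
`X` and `Y` differs from `|X||Y|/2` by at most `θ N²`. -/
def IsQuasirandom (C : Coloring N) (θ : ℝ) : Prop :=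
  ∀ X Y : Finset (Fin N), Disjoint X Y →
    |((C.blue.interedges X Y).card : ℝ) - 1 / 2 * (X.card : ℝ) * (Y.card : ℝ)| ≤ θ * (N : ℝ) ^ 2

/-- `Q` is the vertex set of a monochromatic `K_k`: it has `k` vertices, and all edges inside it
have the same color `c`. -/
def IsMonoClique (C : Coloring N) (k : ℕ) (Q : Finset (Fin N)) : Prop :=
  ∃ c : Fin 2, (C.labelGraph c).IsNClique k Q

instance (C : Coloring N) (k : ℕ) : DecidablePred (C.IsMonoClique k) := fun Q =>
  inferInstanceAs (Decidable (∃ c : Fin 2, (C.labelGraph c).IsNClique k Q))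

/-- The extensions of `Q` (a `K_k`) to a monochromatic `K_{k+1}`: the vertices outside `Q` which
together with `Q` span a monochromatic `K_{k+1}`. -/
def extensions (C : Coloring N) (k : ℕ) (Q : Finset (Fin N)) : Finset (Fin N) :=
  Finset.univ.filter fun v => v ∉ Q ∧ C.IsMonoClique (k + 1) (insert v Q)

/-- The monochromatic `K_k` having at least `t` extensions to a monochromatic `K_{k+1}`. -/
noncomputable def richCliques (C : Coloring N) (k : ℕ) (t : ℝ) : Finset (Finset (Fin N)) :=
  open Classical in
  Finset.univ.filter fun Q => C.IsMonoClique k Q ∧ t ≤ ((C.extensions k Q).card : ℝ)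

end Coloring

/-!
A coloring with few rich cliques is quasirandom. Szemerédi's regularity lemma, applied to the blue
graph, gives a partition into parts `V i` such that most pairs of parts are uniform, with blue
density `d 1 i j` and red density `d 0 i j = 1 - d 1 i j`. If a positive proportion of the
`k`-tuples in `V (i 1) × ⋯ × V (i k)` are cliques of color `c`, then their average number of
extensions is at least about `N * ∑ j, w j * ∏ a, d c (i a) j`, where `w` is the relative size of
the parts (`sum_prod_edgeDensity_le`). As few cliques are rich, this sum is at most `2 ^ (-k)`, up
to a small error. There are two sources of such tuples.

* By Ramsey's theorem in supersaturated form (`exists_le_card_cliqueTuples_or`), each part `V i`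
  contains a positive proportion of cliques of some color `col i`, whence
  `∑ j, w j * d (col i) i j ^ k ≲ 2 ^ (-k)`. Note that no part has to be uniform with itself.
* By the counting lemma (`exists_le_card_cliqueTuples`), `k` parts that are pairwise uniform with
  densities at least `δ` in color `c` span a positive proportion of cliques of color `c`, whence
  `∑ j, w j * ∏ a, d c (i a) j ≲ 2 ^ (-k)`.

What remains is a statement about the densities (`WeightedColoring.IsBookBounded.sum_dist_le`):
almost all of them are close to `1/2`. Let `c` be a color such that the parts with `col i ≠ c`
carry half of the weight. The first bound shows that such a part has density `< δ` in color `c` to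
only about a proportion `2 ^ (-k)` of the other parts. As `(k - 1) * 2 ^ (-k) < 1/2`, a greedy
choice gives `k` such parts `i 1, …, i k` that form a `δ`-dense clique of color `c`. Both bounds
apply to them, and the inequality `∏ a, x a + (∑ a, (1 - x a) ^ k) / k ≥ 2 ^ (1 - k)` on the unit
cube, in which equality forces the mean of the `x a` to be `1/2` (`le_bookFun`), together with the
equality case of Jensen's inequality, shows that each `i a` has densities close to `1/2` to almost
all parts. In particular `k - 1` of them form a clique together with almost any further part `j`
with `col j ≠ c`; the second bound then says that the mean density of `j` in color `c` is at most
about `1/2`, the first one that the `k`-th moment of its complement is at most about `2 ^ (-k)`,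
and so `j` also has densities close to `1/2`. Thus almost all parts with `col j ≠ c` do, so that
they contain cliques of both colors, and the same argument applies to the parts with `col j = c`.
-/

open Finset

namespace BookRegularity

/-! ### Convexity inequalities -/

/-- A quantitative tangent-line bound for the `(n + 2)`-nd power. -/
lemma tangent_add_sq_le_pow (n : ℕ) {l u : ℝ} (hl : 0 ≤ l) (hu : 0 ≤ u) :
    l ^ (n + 2) + (n + 2) * l ^ (n + 1) * (u - l) + l ^ n * (u - l) ^ 2 ≤ u ^ (n + 2) := by
  induction n with
  | zero => norm_num; nlinarith
  | succ n ih =>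
    have h := mul_le_mul_of_nonneg_left ih hu
    have h2 : 0 ≤ l ^ n * ((u - l) ^ 2 * ((n + 1) * l + u)) := by positivity
    push_cast
    have e : u ^ (n + 1 + 2) = u * u ^ (n + 2) := by ring
    rw [e]
    refine le_trans (le_of_sub_nonneg ?_) h
    have : u * (l ^ (n + 2) + (n + 2) * l ^ (n + 1) * (u - l) + l ^ n * (u - l) ^ 2)
      - (l ^ (n + 1 + 2) + (n + 1 + 2) * l ^ (n + 1 + 1) * (u - l) + l ^ (n + 1) * (u - l) ^ 2)
      = l ^ n * ((u - l) ^ 2 * ((n + 1) * l + u)) := by ring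
    rw [this]
    exact h2

/-- The equality case of Young's inequality for the exponents `n + 2` and `(n + 2) / (n + 1)`. -/
lemma eq_of_pow_add_le (n : ℕ) {l u : ℝ} (hl : 0 ≤ l) (hu : 0 ≤ u)
    (h : u ^ (n + 2) + (n + 1) * l ^ (n + 2) ≤ (n + 2) * l ^ (n + 1) * u) : u = l := by
  rcases hl.eq_or_lt with rfl | hl'
  · have : u ^ (n + 2) ≤ 0 := by simpa using h
    exact pow_eq_zero_iff (by omega) |>.1 (le_antisymm this (by positivity))
  · have h1 := tangent_add_sq_le_pow n hl hu
    have h2 : l ^ n * (u - l) ^ 2 ≤ 0 := by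
      have e : l ^ (n + 2) = l ^ (n + 1) * l := by ring
      rw [e] at h h1
      nlinarith
    have h3 : (u - l) ^ 2 ≤ 0 := by
      have := pow_pos hl' n
      by_contra hc
      push Not at hc
      nlinarith [mul_pos this hc]
    nlinarith [pow_eq_zero_iff (two_ne_zero) |>.1 (le_antisymm h3 (sq_nonneg _))]

/-- The average number of extensions, up to normalisation, that a vertex with blue densities `x a`
towards `k` blocks gives to a blue transversal clique and to the red cliques inside the blocks. -/
noncomputable def bookFun {k : ℕ} (x : Fin k → ℝ) : ℝ :=
  ∏ a, x a + (∑ a, (1 - x a) ^ k) / k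

lemma continuous_bookFun {k : ℕ} : Continuous (bookFun (k := k)) := by
  unfold bookFun
  fun_prop

lemma bookFun_half {k : ℕ} (hk : k ≠ 0) :
    bookFun (fun _ : Fin k => (1 / 2 : ℝ)) = 2 * (1 / 2) ^ k := by
  have : (k : ℝ) ≠ 0 := by exact_mod_cast hk
  simp only [bookFun, prod_const, sum_const, card_univ, Fintype.card_fin, nsmul_eq_mul]
  field_simp
  norm_num
  ring

/-- The first-order condition at a minimiser of `bookFun` on the unit cube. -/
lemma one_sub_pow_eq_prod_erase {n : ℕ} {x : Fin (n + 2) → ℝ} (hx : ∀ a, 0 ≤ x a ∧ x a ≤ 1)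
    (hmin : ∀ y : Fin (n + 2) → ℝ, (∀ a, 0 ≤ y a ∧ y a ≤ 1) → bookFun x ≤ bookFun y)
    (i : Fin (n + 2)) : (1 - x i) ^ (n + 1) = ∏ a ∈ univ.erase i, x a := by
  set P := ∏ a ∈ univ.erase i, x a with hP
  have hP0 : 0 ≤ P := prod_nonneg fun a _ => (hx a).1
  have hP1 : P ≤ 1 := prod_le_one (fun a _ => (hx a).1) fun a _ => (hx a).2
  obtain ⟨l, hl0, hl⟩ : ∃ l : ℝ, 0 ≤ l ∧ l ^ (n + 1) = P :=
    ⟨P ^ ((n + 1 : ℕ) : ℝ)⁻¹, by positivity, Real.rpow_inv_natCast_pow hP0 (by omega)⟩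
  have hl1 : l ≤ 1 := by
    by_contra hc
    push Not at hc
    have := one_lt_pow₀ hc (n := n + 1) (by omega)
    linarith
  have key := hmin (Function.update x i (1 - l)) (by
    intro a
    by_cases ha : a = i
    · subst ha; simp [hl0, hl1]
    · simpa [ha] using hx a)
  have e1 : ∀ y : Fin (n + 2) → ℝ, bookFun y = y i * ∏ a ∈ univ.erase i, y a
      + ((1 - y i) ^ (n + 2) + ∑ a ∈ univ.erase i, (1 - y a) ^ (n + 2)) / (n + 2) := by
    intro y
    rw [bookFun, ← mul_prod_erase univ y (mem_univ i),
      ← add_sum_erase univ (fun a => (1 - y a) ^ (n + 2)) (mem_univ i)]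
    push_cast
    rfl
  rw [e1, e1] at key
  have e2 : ∏ a ∈ univ.erase i, Function.update x i (1 - l) a = P :=
    prod_congr rfl fun a ha => by simp [ne_of_mem_erase ha]
  have e3 : ∑ a ∈ univ.erase i, (1 - Function.update x i (1 - l) a) ^ (n + 2)
      = ∑ a ∈ univ.erase i, (1 - x a) ^ (n + 2) :=
    sum_congr rfl fun a ha => by simp [ne_of_mem_erase ha]
  rw [e2, e3, ← hP] at key
  simp only [Function.update_self, sub_sub_cancel] at key
  have hn : (0 : ℝ) < n + 2 := by positivity
  have : 1 - x i = l := by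
    refine eq_of_pow_add_le n hl0 (by linarith [(hx i).2]) ?_
    rw [hl]
    have e4 : l ^ (n + 2) = P * l := by rw [← hl]; ring
    rw [e4] at key ⊢
    rw [add_div, add_div] at key
    have h5 : (1 - x i) ^ (n + 2) / (n + 2) ≤ P * l / (n + 2) + P * (1 - l) - P * x i := by
      linarith
    rw [div_le_iff₀ hn] at h5
    have h6 : P * l / (n + 2) * (n + 2) = P * l := by field_simp
    nlinarith
  rw [this, hl]

lemma eq_max_of_prod_eq_pow {ι : Type*} {s : Finset ι} {x : ι → ℝ} {y : ℝ} (hy : 0 < y)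
    (h0 : ∀ a ∈ s, 0 ≤ x a) (hxy : ∀ a ∈ s, x a ≤ y) (h : ∏ a ∈ s, x a = y ^ #s) :
    ∀ a ∈ s, x a = y := by
  have hpos : ∀ a ∈ s, 0 < x a := by
    intro a ha
    refine lt_of_le_of_ne (h0 a ha) fun hc => ?_
    rw [prod_eq_zero ha hc.symm] at h
    exact (pow_pos hy _).ne h
  intro a ha
  by_contra hne
  have : ∏ a ∈ s, x a < ∏ _a ∈ s, y :=
    prod_lt_prod hpos hxy ⟨a, ha, lt_of_le_of_ne (hxy a ha) hne⟩
  rw [prod_const] at this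
  exact this.ne h

/-- At a minimiser of `bookFun` on the unit cube, the smallest and the largest coordinate add up
to `1`; this pins down the minimiser for `k ≥ 3`, and its mean for `k = 2`. -/
lemma sum_eq_of_isMin_bookFun {n : ℕ} {x : Fin (n + 2) → ℝ} (hx : ∀ a, 0 ≤ x a ∧ x a ≤ 1)
    (hmin : ∀ y : Fin (n + 2) → ℝ, (∀ a, 0 ≤ y a ∧ y a ≤ 1) → bookFun x ≤ bookFun y) :
    ∑ a, x a = (n + 2) / 2 ∧ bookFun x = 2 * (1 / 2) ^ (n + 2) := by
  have crit := one_sub_pow_eq_prod_erase hx hmin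
  obtain ⟨i, -, hi⟩ := exists_min_image univ x ⟨0, mem_univ _⟩
  obtain ⟨j, -, hj⟩ := exists_max_image univ x ⟨0, mem_univ _⟩
  have hcard : ∀ i : Fin (n + 2), #(univ.erase i) = n + 1 := fun i => by simp
  have h1 : 1 - x i ≤ x j := by
    refine le_of_pow_le_pow_left₀ (n := n + 1) (by omega) (hx j).1 ?_
    rw [crit i, ← hcard i, ← prod_const]
    exact prod_le_prod (fun a _ => (hx a).1) fun a _ => hj a (mem_univ a)
  have h2 : x i ≤ 1 - x j := by
    refine le_of_pow_le_pow_left₀ (n := n + 1) (by omega) (by linarith [(hx j).2]) ?_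
    rw [crit j, ← hcard j, ← prod_const]
    exact prod_le_prod (fun a _ => (hx i).1) fun a _ => hi a (mem_univ a)
  have hij : x i + x j = 1 := by linarith
  have hle := hi j (mem_univ j)
  have hothers : ∀ a ∈ univ.erase i, x a = x j := by
    refine eq_max_of_prod_eq_pow (by linarith) (fun a _ => (hx a).1)
      (fun a _ => hj a (mem_univ a)) ?_
    rw [← crit i, hcard]
    congr 1
    linarith
  have hsum : ∑ a, x a = x i + (n + 1) * x j := by
    rw [← add_sum_erase univ x (mem_univ i), sum_congr rfl hothers]
    simp
  have hval : bookFun x = x i * x j ^ (n + 1)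
      + (x j ^ (n + 2) + (n + 1) * x i ^ (n + 2)) / (n + 2) := by
    rw [bookFun, ← mul_prod_erase univ x (mem_univ i), prod_congr rfl hothers,
      ← add_sum_erase univ (fun a => (1 - x a) ^ (n + 2)) (mem_univ i),
      sum_congr rfl fun a ha => by rw [hothers a ha], prod_const, sum_const, hcard]
    have e1 : 1 - x i = x j := by linarith
    have e2 : 1 - x j = x i := by linarith
    rw [e1, e2]
    simp
  by_cases hhalf : x i = x j
  · have e1 : x j = 1 / 2 := by linarith
    have e2 : x i = 1 / 2 := by linarith
    refine ⟨by rw [hsum, e1, e2]; ring, ?_⟩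
    rw [hval, e1, e2]
    field_simp
    ring
  rcases Nat.eq_zero_or_pos n with rfl | hn
  · have e2 : x i = 1 - x j := by linarith
    rw [hsum, hval, e2]
    constructor
    · norm_num
    · norm_num; ring
  exfalso
  have hne : i ≠ j := fun h => hhalf (by rw [h])
  have hlt : x i < x j := lt_of_le_of_ne hle hhalf
  -- the first-order condition at the largest coordinate
  have hc : x i ^ (n + 1) = x i * x j ^ n := by
    have := crit j
    rw [← mul_prod_erase (univ.erase j) x (mem_erase.2 ⟨hne, mem_univ i⟩),
      prod_congr rfl (g := fun _ => x j) (fun a ha => hothers a (by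
        simp only [mem_erase] at ha ⊢; exact ⟨ha.1, mem_univ a⟩)), prod_const,
      card_erase_of_mem (mem_erase.2 ⟨hne, mem_univ i⟩), hcard] at this
    rw [show 1 - x j = x i by linarith] at this
    simpa using this
  rcases (hx i).1.eq_or_lt with h0 | h0
  · -- the remaining critical point has a coordinate `0` and the others `1`; it is no minimiser
    have hmin' := hmin (fun _ => 1 / 2) (fun _ => by norm_num)
    have e1 : x j = 1 := by linarith
    rw [bookFun_half (by omega), hval, ← h0, e1] at hmin'
    have h3 : (n + 2 : ℝ) < 2 ^ (n + 1) := by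
      have : n + 2 < 2 ^ (n + 1) := by
        obtain ⟨m, rfl⟩ : ∃ m, n = m + 1 := ⟨n - 1, by omega⟩
        clear * -
        induction m with
        | zero => norm_num
        | succ m ih => rw [pow_succ]; linarith
      exact_mod_cast this
    simp only [zero_mul, one_pow, zero_add] at hmin'
    rw [zero_pow (by omega), mul_zero, add_zero, div_le_iff₀ (by positivity), one_div,
      inv_pow] at hmin'
    have h4 : (2 : ℝ) * (2 ^ (n + 2))⁻¹ = (2 ^ (n + 1))⁻¹ := by
      rw [pow_succ 2 (n + 1)]; field_simp
    rw [h4, inv_mul_eq_div, le_div_iff₀ (by positivity)] at hmin'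
    linarith
  · rw [pow_succ, mul_comm] at hc
    have := mul_left_cancel₀ h0.ne' hc
    exact absurd (pow_lt_pow_left₀ hlt h0.le hn.ne') (by linarith)

lemma isCompact_cube (k : ℕ) : IsCompact {x : Fin k → ℝ | ∀ a, 0 ≤ x a ∧ x a ≤ 1} := by
  convert isCompact_Icc (a := (0 : Fin k → ℝ)) (b := 1) using 1
  ext x
  simp [Pi.le_def, forall_and]

/-- The minimum of `bookFun` on the cube is `2 ^ (1 - k)`, attained only at points of mean `1/2`. -/
lemma le_bookFun {k : ℕ} (hk : 2 ≤ k) {x : Fin k → ℝ} (hx : ∀ a, 0 ≤ x a ∧ x a ≤ 1) :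
    2 * (1 / 2) ^ k ≤ bookFun x ∧ (bookFun x = 2 * (1 / 2) ^ k → ∑ a, x a = k / 2) := by
  obtain ⟨n, rfl⟩ : ∃ n, k = n + 2 := ⟨k - 2, by omega⟩
  obtain ⟨z, hz, hzmin⟩ := (isCompact_cube (n + 2)).exists_isMinOn ⟨x, hx⟩
    continuous_bookFun.continuousOn
  have hz' := (sum_eq_of_isMin_bookFun hz fun y hy => hzmin hy).2
  refine ⟨hz' ▸ hzmin hx, fun h => ?_⟩
  have := (sum_eq_of_isMin_bookFun hx fun y hy => by rw [h, ← hz']; exact hzmin hy).1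
  rw [this]
  push_cast
  ring

lemma bookFun_stability {k : ℕ} (hk : 2 ≤ k) {η : ℝ} (hη : 0 < η) :
    ∃ ζ > 0, ∀ x : Fin k → ℝ, (∀ a, 0 ≤ x a ∧ x a ≤ 1) → η ≤ |∑ a, x a - k / 2| →
      2 * (1 / 2) ^ k + ζ ≤ bookFun x := by
  have hK : IsCompact ({x : Fin k → ℝ | ∀ a, 0 ≤ x a ∧ x a ≤ 1} ∩
      {x : Fin k → ℝ | η ≤ |∑ a, x a - k / 2|}) :=
    (isCompact_cube k).inter_right (isClosed_le continuous_const (by fun_prop))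
  rcases Set.eq_empty_or_nonempty ({x : Fin k → ℝ | ∀ a, 0 ≤ x a ∧ x a ≤ 1} ∩
      {x : Fin k → ℝ | η ≤ |∑ a, x a - k / 2|}) with he | hne
  · refine ⟨1, one_pos, fun x hx hx' => ?_⟩
    exact absurd (show x ∈ (∅ : Set (Fin k → ℝ)) from he ▸ ⟨hx, hx'⟩) (by simp)
  obtain ⟨z, ⟨hz, hzη⟩, hzmin⟩ := hK.exists_isMinOn hne continuous_bookFun.continuousOn
  have h := le_bookFun hk hz
  refine ⟨bookFun z - 2 * (1 / 2) ^ k, sub_pos.2 (lt_of_le_of_ne h.1 fun hc => ?_), ?_⟩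
  · have h1 := h.2 hc.symm
    have h2 : η ≤ |∑ a, z a - k / 2| := hzη
    rw [h1] at h2
    simp at h2
    linarith
  · intro x hx hx'
    have : bookFun z ≤ bookFun x := hzmin ⟨hx, hx'⟩
    linarith

/-! ### Weighted averages -/

lemma average_bookFun_stability {k : ℕ} (hk : 2 ≤ k) {η : ℝ} (hη : 0 < η) :
    ∃ ζ > 0, ∀ (ι : Type) [Fintype ι] (w : ι → ℝ) (x : Fin k → ι → ℝ), (∀ j, 0 ≤ w j) →
      ∑ j, w j = 1 → (∀ a j, 0 ≤ x a j ∧ x a j ≤ 1) →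
      ∑ j, w j * ∏ a, x a j ≤ (1 / 2) ^ k + ζ →
      (∀ a, ∑ j, w j * (1 - x a j) ^ k ≤ (1 / 2) ^ k + ζ) →
      ∑ j, w j * |∑ a, x a j - k / 2| ≤ η := by
  obtain ⟨ξ, hξ, hstab⟩ := bookFun_stability hk (half_pos hη)
  have hk0 : (0 : ℝ) < k := by exact_mod_cast (by omega : 0 < k)
  refine ⟨η * ξ / (4 * k), by positivity, fun ι _ w x hw hw1 hx hprod hpow => ?_⟩
  have hpt : ∀ j, |∑ a, x a j - k / 2| ≤
      η / 2 + k / ξ * (bookFun (fun a => x a j) - 2 * (1 / 2) ^ k) := by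
    intro j
    have h1 := (le_bookFun hk (x := fun a => x a j) fun a => hx a j).1
    rcases lt_or_ge |∑ a, x a j - k / 2| (η / 2) with h | h
    · have : 0 ≤ k / ξ * (bookFun (fun a => x a j) - 2 * (1 / 2) ^ k) :=
        mul_nonneg (by positivity) (by linarith)
      linarith
    · have h2 := hstab (fun a => x a j) (fun a => hx a j) h
      have h3 : (k : ℝ) / ξ * ξ ≤ k / ξ * (bookFun (fun a => x a j) - 2 * (1 / 2) ^ k) :=
        mul_le_mul_of_nonneg_left (by linarith) (by positivity)
      have h4 : (k : ℝ) / ξ * ξ = k := by field_simp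
      have h5 : ∑ a, x a j ≤ k := by
        calc ∑ a, x a j ≤ ∑ _a : Fin k, (1 : ℝ) := sum_le_sum fun a _ => (hx a j).2
          _ = k := by simp
      have h6 : 0 ≤ ∑ a, x a j := sum_nonneg fun a _ => (hx a j).1
      have h7 : |∑ a, x a j - k / 2| ≤ k := abs_le.2 ⟨by linarith, by linarith⟩
      linarith
  have hG : ∑ j, w j * bookFun (fun a => x a j) ≤ 2 * (1 / 2) ^ k + 2 * (η * ξ / (4 * k)) := by
    have e : ∀ j, w j * bookFun (fun a => x a j)
        = w j * ∏ a, x a j + (∑ a, w j * (1 - x a j) ^ k) / k := by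
      intro j
      rw [bookFun, mul_add, ← mul_sum]
      ring
    rw [sum_congr rfl fun j _ => e j, sum_add_distrib, ← sum_div, sum_comm]
    have h2 : (∑ a, ∑ j, w j * (1 - x a j) ^ k) / k ≤ (1 / 2) ^ k + η * ξ / (4 * k) := by
      rw [div_le_iff₀ hk0]
      calc ∑ a, ∑ j, w j * (1 - x a j) ^ k
          ≤ ∑ _a : Fin k, ((1 / 2) ^ k + η * ξ / (4 * k)) := sum_le_sum fun a _ => hpow a
        _ = _ := by simp; ring
    linarith
  calc ∑ j, w j * |∑ a, x a j - k / 2|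
      ≤ ∑ j, w j * (η / 2 + k / ξ * (bookFun (fun a => x a j) - 2 * (1 / 2) ^ k)) :=
        sum_le_sum fun j _ => mul_le_mul_of_nonneg_left (hpt j) (hw j)
    _ = η / 2 * ∑ j, w j + k / ξ * (∑ j, w j * bookFun (fun a => x a j)
          - 2 * (1 / 2) ^ k * ∑ j, w j) := by
        rw [mul_sub, mul_sum, mul_sum, mul_sum, mul_sum, ← sum_sub_distrib, ← sum_add_distrib]
        exact sum_congr rfl fun j _ => by ring
    _ ≤ η / 2 + k / ξ * (2 * (η * ξ / (4 * k))) := by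
        rw [hw1]
        have := mul_le_mul_of_nonneg_left (sub_le_sub_right hG (2 * (1 / 2) ^ k))
          (show (0 : ℝ) ≤ k / ξ by positivity)
        simp only [add_sub_cancel_left] at this
        linarith
    _ = η := by field_simp; norm_num

/-- Jensen's inequality for the `k`-th power around `1/2`, with the variance as error term. -/
lemma average_pow_bound {k : ℕ} (hk : 2 ≤ k) {ι : Type} [Fintype ι] {w r : ι → ℝ}
    (hw : ∀ j, 0 ≤ w j) (hw1 : ∑ j, w j = 1) (hr : ∀ j, 0 ≤ r j) {ζ : ℝ}
    (hζ0 : 0 ≤ ζ) (h : ∑ j, w j * r j ^ k ≤ (1 / 2) ^ k + ζ) :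
    k / 2 * (∑ j, w j * r j - 1 / 2) + ∑ j, w j * (r j - 1 / 2) ^ 2 ≤ 2 ^ k * ζ := by
  obtain ⟨n, rfl⟩ : ∃ n, k = n + 2 := ⟨k - 2, by omega⟩
  have hpt : ∀ j, w j * ((1 / 2) ^ (n + 2))
      + (n + 2) * (1 / 2) ^ (n + 1) * (w j * r j - w j * (1 / 2))
      + (1 / 2) ^ n * (w j * (r j - 1 / 2) ^ 2) ≤ w j * r j ^ (n + 2) := by
    intro j
    have := mul_le_mul_of_nonneg_left
      (tangent_add_sq_le_pow n (by norm_num : (0 : ℝ) ≤ 1 / 2) (hr j)) (hw j)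
    linarith
  have hs := sum_le_sum fun j (_ : j ∈ univ) => hpt j
  rw [sum_add_distrib, sum_add_distrib, ← sum_mul, ← mul_sum, ← mul_sum, sum_sub_distrib,
    ← sum_mul, hw1] at hs
  have hs' : (n + 2) * (1 / 2) ^ (n + 1) * (∑ j, w j * r j - 1 / 2)
      + (1 / 2) ^ n * ∑ j, w j * (r j - 1 / 2) ^ 2 ≤ ζ := by linarith
  have hζ := mul_le_mul_of_nonneg_left hs' (show (0 : ℝ) ≤ 2 ^ n by positivity)
  have e : (2 : ℝ) ^ n * ((n + 2) * (1 / 2) ^ (n + 1) * (∑ j, w j * r j - 1 / 2)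
      + (1 / 2) ^ n * ∑ j, w j * (r j - 1 / 2) ^ 2)
      = ((n + 2 : ℕ) : ℝ) / 2 * (∑ j, w j * r j - 1 / 2) + ∑ j, w j * (r j - 1 / 2) ^ 2 := by
    have e1 : (2 : ℝ) ^ n * (1 / 2) ^ n = 1 := by rw [← mul_pow]; norm_num
    push_cast
    linear_combination ((n + 2) * (1 / 2) * (∑ j, w j * r j - 1 / 2)
      + ∑ j, w j * (r j - 1 / 2) ^ 2) * e1
  rw [e] at hζ
  calc _ ≤ 2 ^ n * ζ := hζ
    _ ≤ 2 ^ (n + 2) * ζ := by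
      refine mul_le_mul_of_nonneg_right (pow_le_pow_right₀ (by norm_num) (by omega)) hζ0

lemma average_le_of_average_pow_le {k : ℕ} (hk : 2 ≤ k) {ι : Type} [Fintype ι] {w r : ι → ℝ}
    (hw : ∀ j, 0 ≤ w j) (hw1 : ∑ j, w j = 1) (hr : ∀ j, 0 ≤ r j) {ζ : ℝ}
    (hζ0 : 0 ≤ ζ) (h : ∑ j, w j * r j ^ k ≤ (1 / 2) ^ k + ζ) :
    ∑ j, w j * r j ≤ 1 / 2 + 2 ^ k * ζ := by
  have h1 := average_pow_bound hk hw hw1 hr hζ0 h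
  have h2 : 0 ≤ ∑ j, w j * (r j - 1 / 2) ^ 2 :=
    sum_nonneg fun j _ => mul_nonneg (hw j) (sq_nonneg _)
  have hk' : (2 : ℝ) ≤ k := by exact_mod_cast hk
  have h3 : 0 ≤ 2 ^ k * ζ := by positivity
  rcases le_total (∑ j, w j * r j - 1 / 2) 0 with h4 | h4
  · linarith
  · nlinarith

lemma average_pow_stability {k : ℕ} (hk : 2 ≤ k) {η : ℝ} (hη : 0 < η) :
    ∃ ζ > 0, ∀ (ι : Type) [Fintype ι] (w r : ι → ℝ), (∀ j, 0 ≤ w j) → ∑ j, w j = 1 →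
      (∀ j, 0 ≤ r j) → ∑ j, w j * r j ^ k ≤ (1 / 2) ^ k + ζ → 1 / 2 - ζ ≤ ∑ j, w j * r j →
      ∑ j, w j * |r j - 1 / 2| ≤ η := by
  refine ⟨η ^ 2 / (2 ^ k + k), by positivity, fun ι _ w r hw hw1 hr hpow hmean => ?_⟩
  set ζ := η ^ 2 / (2 ^ k + k) with hζ
  have hζ0 : 0 < ζ := by positivity
  have h1 := average_pow_bound hk hw hw1 hr hζ0.le hpow
  have h2 : ∑ j, w j * (r j - 1 / 2) ^ 2 ≤ η ^ 2 := by
    have e : (2 ^ k + k) * ζ = η ^ 2 := by rw [hζ]; field_simp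
    have h3 : (k : ℝ) / 2 * (-ζ) ≤ k / 2 * (∑ j, w j * r j - 1 / 2) :=
      mul_le_mul_of_nonneg_left (by linarith) (by positivity)
    nlinarith [show (0 : ℝ) ≤ k * ζ by positivity]
  have hpt : ∀ j, |r j - 1 / 2| ≤ η / 2 + (r j - 1 / 2) ^ 2 / (2 * η) := by
    intro j
    rw [← sub_nonneg]
    have : η / 2 + (r j - 1 / 2) ^ 2 / (2 * η) - |r j - 1 / 2|
        = (η - |r j - 1 / 2|) ^ 2 / (2 * η) := by
      rw [← sq_abs (r j - 1 / 2)]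
      field_simp
      ring
    rw [this]
    positivity
  calc ∑ j, w j * |r j - 1 / 2|
      ≤ ∑ j, w j * (η / 2 + (r j - 1 / 2) ^ 2 / (2 * η)) :=
        sum_le_sum fun j _ => mul_le_mul_of_nonneg_left (hpt j) (hw j)
    _ = η / 2 * ∑ j, w j + (∑ j, w j * (r j - 1 / 2) ^ 2) / (2 * η) := by
        rw [mul_sum, sum_div, ← sum_add_distrib]
        exact sum_congr rfl fun j _ => by ring
    _ ≤ η / 2 + η ^ 2 / (2 * η) := by rw [hw1]; gcongr; linarith
    _ = η := by field_simp; norm_num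

lemma abs_prod_sub_prod_le {n : ℕ} {f g : Fin n → ℝ} (hf : ∀ a, 0 ≤ f a ∧ f a ≤ 1)
    (hg : ∀ a, 0 ≤ g a ∧ g a ≤ 1) : |∏ a, f a - ∏ a, g a| ≤ ∑ a, |f a - g a| := by
  induction n with
  | zero => simp
  | succ n ih =>
    rw [Fin.prod_univ_succ, Fin.prod_univ_succ, Fin.sum_univ_succ]
    have h := ih (fun a => hf a.succ) (fun a => hg a.succ)
    have hG0 : 0 ≤ ∏ a : Fin n, g a.succ := prod_nonneg fun a _ => (hg _).1
    have hG1 : ∏ a : Fin n, g a.succ ≤ 1 := prod_le_one (fun a _ => (hg _).1) fun a _ => (hg _).2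
    have e : f 0 * ∏ a : Fin n, f a.succ - g 0 * ∏ a : Fin n, g a.succ
        = (f 0 - g 0) * ∏ a : Fin n, g a.succ
          + f 0 * (∏ a : Fin n, f a.succ - ∏ a : Fin n, g a.succ) := by ring
    rw [e]
    refine (abs_add_le _ _).trans ?_
    rw [abs_mul, abs_mul, abs_of_nonneg hG0, abs_of_nonneg (hf 0).1]
    refine add_le_add (mul_le_of_le_one_right (abs_nonneg _) hG1) ?_
    exact (mul_le_of_le_one_left (abs_nonneg _) (hf 0).2).trans h

/-- If `n` of the `n + 1` density functions of a clique are close to `1/2`, then the bound on the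
average product forces the mean of the last one below `1/2`, and its bound on the `(n + 1)`-st
moment then forces it close to `1/2`. -/
lemma last_density_stability {n : ℕ} (hn : 1 ≤ n) {η : ℝ} (hη : 0 < η) :
    ∃ ζ > 0, ∀ (ι : Type) [Fintype ι] (w b : ι → ℝ) (y : Fin n → ι → ℝ), (∀ j, 0 ≤ w j) →
      ∑ j, w j = 1 → (∀ j, 0 ≤ b j ∧ b j ≤ 1) → (∀ a j, 0 ≤ y a j ∧ y a j ≤ 1) →
      ∑ j, w j * (b j * ∏ a, y a j) ≤ (1 / 2) ^ (n + 1) + ζ →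
      ∑ j, w j * (1 - b j) ^ (n + 1) ≤ (1 / 2) ^ (n + 1) + ζ →
      (∀ a, ∑ j, w j * |y a j - 1 / 2| ≤ ζ) → ∑ j, w j * |b j - 1 / 2| ≤ η := by
  obtain ⟨ξ, hξ, hstab⟩ := average_pow_stability (k := n + 1) (by omega) hη
  have hc : (1 : ℝ) ≤ 2 ^ n * (n + 1) := by
    have h1 : (1 : ℝ) ≤ 2 ^ n := one_le_pow₀ (by norm_num)
    have h2 : (1 : ℝ) ≤ n + 1 := by linarith [(Nat.cast_nonneg n : (0 : ℝ) ≤ n)]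
    nlinarith
  refine ⟨ξ / (2 ^ n * (n + 1)), by positivity,
    fun ι _ w b y hw hw1 hb hy hprod hpow hdist => ?_⟩
  set ζ := ξ / (2 ^ n * (n + 1)) with hζ
  have hζξ : ζ * (2 ^ n * (n + 1)) = ξ := by rw [hζ]; field_simp
  have hζle : ζ ≤ ξ := div_le_self hξ.le hc
  have hpt : ∀ j, (1 / 2) ^ n * (w j * b j) ≤ w j * (b j * ∏ a, y a j)
      + ∑ a, w j * |y a j - 1 / 2| := by
    intro j
    have h1 := abs_prod_sub_prod_le (fun a => hy a j) (g := fun _ => 1 / 2)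
      (fun _ => by norm_num)
    rw [prod_const, card_univ, Fintype.card_fin] at h1
    have h2 : b j * ((1 / 2) ^ n - ∏ a, y a j) ≤ ∑ a, |y a j - 1 / 2| := by
      calc b j * ((1 / 2) ^ n - ∏ a, y a j) ≤ b j * |∏ a, y a j - (1 / 2) ^ n| := by
            refine mul_le_mul_of_nonneg_left ?_ (hb j).1
            rw [abs_sub_comm]; exact le_abs_self _
        _ ≤ |∏ a, y a j - (1 / 2) ^ n| := mul_le_of_le_one_left (abs_nonneg _) (hb j).2
        _ ≤ _ := h1
    have h3 := mul_le_mul_of_nonneg_left h2 (hw j)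
    rw [mul_sum] at h3
    linarith
  have hs := sum_le_sum fun j (_ : j ∈ univ) => hpt j
  rw [← mul_sum, sum_add_distrib, sum_comm (f := fun j a => w j * |y a j - 1 / 2|)] at hs
  have hs2 : ∑ a, ∑ j, w j * |y a j - 1 / 2| ≤ n * ζ := by
    calc ∑ a, ∑ j, w j * |y a j - 1 / 2| ≤ ∑ _a : Fin n, ζ := sum_le_sum fun a _ => hdist a
      _ = n * ζ := by simp
  have hs3 : (1 / 2) ^ n * ∑ j, w j * b j ≤ (1 / 2) ^ (n + 1) + (n + 1) * ζ := by linarith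
  have hmean : ∑ j, w j * b j ≤ 1 / 2 + ξ := by
    have h4 := mul_le_mul_of_nonneg_left hs3 (show (0 : ℝ) ≤ 2 ^ n by positivity)
    have e1 : (2 : ℝ) ^ n * (1 / 2) ^ n = 1 := by rw [← mul_pow]; norm_num
    rw [← mul_assoc, e1, one_mul] at h4
    have e2 : (2 : ℝ) ^ n * ((1 / 2) ^ (n + 1) + (n + 1) * ζ) = 1 / 2 + ξ := by
      rw [← hζξ]
      linear_combination (1 / 2) * e1
    linarith
  have := hstab ι w (fun j => 1 - b j) hw hw1 (fun j => by linarith [(hb j).2])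
    (by linarith) (by
      have : ∑ j, w j * (1 - b j) = 1 - ∑ j, w j * b j := by
        simp only [mul_sub, mul_one, sum_sub_distrib, hw1]
      rw [this]; linarith)
  refine le_trans (le_of_eq (sum_congr rfl fun j _ => ?_)) this
  rw [← abs_neg]
  congr 2
  ring

/-! ### The weighted reduced coloring -/

/-- A weighted two-coloring: points `i` with weights `w i` of total weight `1`, and for each color
`c` the density `d c i j` of the edges of color `c` between `i` and `j`. Different colors have
complementary densities. -/
structure WeightedColoring (ι : Type) [Fintype ι] where
  w : ι → ℝ
  d : Fin 2 → ι → ι → ℝ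
  w_nonneg : ∀ i, 0 ≤ w i
  sum_w : ∑ i, w i = 1
  d_nonneg : ∀ c i j, 0 ≤ d c i j
  d_symm : ∀ c i j, d c i j = d c j i
  d_add : ∀ c c' i j, c ≠ c' → d c i j + d c' i j = 1

namespace WeightedColoring

variable {ι : Type} [Fintype ι] (S : WeightedColoring ι)

lemma d_le_one (c : Fin 2) (i j : ι) : S.d c i j ≤ 1 := by
  obtain ⟨c', hc'⟩ := exists_ne c
  linarith [S.d_add c c' i j hc'.symm, S.d_nonneg c' i j]

/-- The average distance from `1/2` of the densities at `i`. -/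
noncomputable def dist (i : ι) : ℝ := ∑ j, S.w j * |S.d 1 i j - 1 / 2|

lemma dist_eq (c : Fin 2) (i : ι) : S.dist i = ∑ j, S.w j * |S.d c i j - 1 / 2| := by
  by_cases hc : c = 1
  · rw [hc, dist]
  · refine sum_congr rfl fun j _ => ?_
    have := S.d_add c 1 i j hc
    rw [show S.d 1 i j - 1 / 2 = -(S.d c i j - 1 / 2) by linarith, abs_neg]

lemma dist_le_one (i : ι) : S.dist i ≤ 1 := by
  rw [← S.sum_w]
  refine sum_le_sum fun j _ => mul_le_of_le_one_right (S.w_nonneg j) (abs_le.2 ?_)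
  constructor <;> linarith [S.d_nonneg 1 i j, S.d_le_one 1 i j]

open Classical in
/-- The total weight of the points with property `P`. -/
noncomputable def wt (P : ι → Prop) : ℝ := ∑ i, if P i then S.w i else 0

lemma wt_true : S.wt (fun _ => True) = 1 := by simp [wt, S.sum_w]

lemma wt_nonneg (P : ι → Prop) : 0 ≤ S.wt P :=
  sum_nonneg fun i _ => by split_ifs; exacts [S.w_nonneg i, le_rfl]

lemma wt_mono {P Q : ι → Prop} (h : ∀ i, P i → Q i) : S.wt P ≤ S.wt Q := by
  refine sum_le_sum fun i _ => ?_
  have := S.w_nonneg i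
  by_cases hP : P i
  · simp [hP, h i hP]
  · rw [if_neg hP]; split_ifs <;> simp [this]

lemma wt_or_le (P Q : ι → Prop) : S.wt (fun i => P i ∨ Q i) ≤ S.wt P + S.wt Q := by
  rw [wt, wt, wt, ← sum_add_distrib]
  refine sum_le_sum fun i _ => ?_
  have := S.w_nonneg i
  by_cases hP : P i <;> by_cases hQ : Q i <;> simp [hP, hQ, this]

lemma wt_exists_le {n : ℕ} {P : Fin n → ι → Prop} {t : ℝ} (h : ∀ a, S.wt (P a) ≤ t) :
    S.wt (fun i => ∃ a, P a i) ≤ n * t := by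
  calc S.wt (fun i => ∃ a, P a i) ≤ ∑ a, S.wt (P a) := by
        simp only [wt]
        rw [sum_comm]
        refine sum_le_sum fun i _ => ?_
        have h0 : ∀ a ∈ (univ : Finset (Fin n)),
            (0 : ℝ) ≤ @ite ℝ (P a i) (Classical.propDecidable _) (S.w i) 0 := by
          intro a _; split_ifs; exacts [S.w_nonneg i, le_rfl]
        split_ifs with hex
        · obtain ⟨a, ha⟩ := hex
          have := single_le_sum h0 (mem_univ a)
          rwa [if_pos ha] at this
        · exact sum_nonneg h0
    _ ≤ ∑ _a : Fin n, t := sum_le_sum fun a _ => h a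
    _ = n * t := by simp

lemma exists_of_wt_pos {P : ι → Prop} (h : 0 < S.wt P) : ∃ i, P i := by
  by_contra hc
  push Not at hc
  simp [wt, hc] at h

/-- Markov's inequality. -/
lemma mul_wt_le {P : ι → Prop} {f : ι → ℝ} (hf : ∀ i, 0 ≤ f i) {t : ℝ}
    (h : ∀ i, P i → t ≤ f i) : t * S.wt P ≤ ∑ i, S.w i * f i := by
  rw [wt, mul_sum]
  refine sum_le_sum fun i _ => ?_
  split_ifs with hP
  · rw [mul_comm]; exact mul_le_mul_of_nonneg_left (h i hP) (S.w_nonneg i)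
  · rw [mul_zero]; exact mul_nonneg (S.w_nonneg i) (hf i)

/-- Greedy choice of points that pairwise avoid a sparse symmetric relation. -/
lemma exists_pairwise_not {R : ι → Prop} {bad : ι → ι → Prop} (hsymm : ∀ i j, bad i j → bad j i)
    {t : ℝ} (ht : 0 ≤ t) (hbad : ∀ i, R i → S.wt (bad i) ≤ t) (m : ℕ) (hm : m * t < S.wt R) :
    ∃ x : Fin (m + 1) → ι, (∀ a, R (x a)) ∧ ∀ a b, a ≠ b → ¬ bad (x a) (x b) := by
  induction m with
  | zero =>
    obtain ⟨i, hi⟩ := S.exists_of_wt_pos (P := R) (by simpa using hm)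
    refine ⟨fun _ => i, fun _ => hi, fun a b hab => absurd (Subsingleton.elim (α := Fin 1) a b) hab⟩
  | succ m ih =>
    obtain ⟨x, hx, hxx⟩ := ih (lt_of_le_of_lt (by push_cast; linarith) hm)
    have h1 := S.wt_exists_le (P := fun a => bad (x a)) fun a => hbad _ (hx a)
    obtain ⟨v, hvR, hv⟩ : ∃ v, R v ∧ ¬ ∃ a, bad (x a) v := by
      by_contra hc
      push Not at hc
      have := S.wt_mono (P := R) (Q := fun i => ∃ a, bad (x a) i) hc
      push_cast at hm h1
      linarith
    push Not at hv
    refine ⟨Fin.cons v x, Fin.cases hvR hx, ?_⟩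
    intro a b
    refine Fin.cases ?_ (fun a => ?_) a <;> refine Fin.cases ?_ (fun b => ?_) b
    · simp
    · intro _; simpa using fun h => hv b (hsymm _ _ h)
    · intro _; simpa using hv a
    · intro hab; simpa using hxx a b (by simpa using hab)

/-- The conditions that a coloring without many rich cliques imposes on its reduced coloring.
The relation `E` marks the exceptional pairs, `T` the typical points, and `col` assigns to each
point a color in which its part has many cliques. -/
structure IsBookBounded (S : WeightedColoring ι) (k : ℕ) (δ ζ : ℝ) (E : ι → ι → Prop)
    (T : ι → Prop) (col : ι → Fin 2) : Prop where
  symm : ∀ i j, E i j → E j i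
  wt_exceptional : ∀ i, T i → S.wt (E i) ≤ ζ
  wt_atypical : S.wt (fun i => ¬ T i) ≤ ζ
  sum_pow_le : ∀ i, T i → ∑ j, S.w j * S.d (col i) i j ^ k ≤ (1 / 2) ^ k + ζ
  sum_prod_le : ∀ (c : Fin 2) (x : Fin k → ι), (∀ a, T (x a)) →
    (∀ a b, a ≠ b → ¬ E (x a) (x b)) → (∀ a b, a ≠ b → δ ≤ S.d c (x a) (x b)) →
    ∑ j, S.w j * ∏ a, S.d c (x a) j ≤ (1 / 2) ^ k + ζ

lemma IsBookBounded.mono {S : WeightedColoring ι} {k : ℕ} {δ ζ ζ' : ℝ} {E : ι → ι → Prop}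
    {T : ι → Prop} {col : ι → Fin 2} (h : S.IsBookBounded k δ ζ E T col) (hζ : ζ ≤ ζ') :
    S.IsBookBounded k δ ζ' E T col where
  symm := h.symm
  wt_exceptional i hi := (h.wt_exceptional i hi).trans hζ
  wt_atypical := h.wt_atypical.trans hζ
  sum_pow_le i hi := (h.sum_pow_le i hi).trans (by linarith)
  sum_prod_le c x h1 h2 h3 := (h.sum_prod_le c x h1 h2 h3).trans (by linarith)

lemma wt_density_lt_le {δ : ℝ} (hδ : δ ≤ 1 / 4) (c : Fin 2) (i : ι) :
    S.wt (fun j => S.d c i j < δ) ≤ 4 * S.dist i := by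
  have := S.mul_wt_le (P := fun j => S.d c i j < δ) (f := fun j => |S.d c i j - 1 / 2|)
    (fun _ => abs_nonneg _) (t := 1 / 4) (fun j hj => by
      rw [abs_sub_comm]; exact le_trans (by linarith) (le_abs_self _))
  rw [← dist_eq] at this
  linarith

/-- Suppose that `n` points with densities close to `1/2` form a clique of color `c`. Almost every
point `j` with `col j ≠ c` extends this clique, and then also has densities close to `1/2`. -/
lemma wt_far_le {n : ℕ} (hn : 1 ≤ n) {η : ℝ} (hη : 0 < η) :
    ∃ ζ₀ > 0, ∀ (ι : Type) [Fintype ι] (S : WeightedColoring ι) (δ ζ : ℝ) (E : ι → ι → Prop)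
      (T : ι → Prop) (col : ι → Fin 2), S.IsBookBounded (n + 1) δ ζ E T col → ζ ≤ ζ₀ → δ ≤ 1 / 4 →
      ∀ (c : Fin 2) (x : Fin n → ι) (t : ℝ), t ≤ ζ₀ → (∀ a, T (x a)) →
      (∀ a b, a ≠ b → ¬ E (x a) (x b)) → (∀ a b, a ≠ b → δ ≤ S.d c (x a) (x b)) →
      (∀ a, S.dist (x a) ≤ t) →
      S.wt (fun j => T j ∧ col j ≠ c ∧ η < S.dist j) ≤ n * (ζ + 4 * t) := by
  obtain ⟨ζ₀, hζ₀, hlast⟩ := last_density_stability hn hη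
  refine ⟨ζ₀, hζ₀, fun ι _ S δ ζ E T col hS hζ hδ c x t ht hxT hxE hxd hxt => ?_⟩
  refine (S.wt_mono fun j hj => ?_).trans
    (S.wt_exists_le (P := fun a j => E (x a) j ∨ S.d c (x a) j < δ) fun a => ?_)
  swap
  · refine (S.wt_or_le _ _).trans (add_le_add (hS.wt_exceptional _ (hxT a)) ?_)
    exact (S.wt_density_lt_le hδ c (x a)).trans (by linarith [hxt a])
  obtain ⟨hjT, hjc, hjd⟩ := hj
  by_contra hne
  push Not at hne
  refine hjd.not_ge ?_
  rw [S.dist_eq c]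
  refine hlast ι S.w (S.d c j) (fun a => S.d c (x a)) S.w_nonneg S.sum_w
    (fun l => ⟨S.d_nonneg _ _ _, S.d_le_one _ _ _⟩)
    (fun a l => ⟨S.d_nonneg _ _ _, S.d_le_one _ _ _⟩) ?_ ?_ ?_
  · have := (hS.mono hζ).sum_prod_le c (Fin.cons j x) (Fin.cases hjT hxT) ?_ ?_
    · simpa only [Fin.prod_univ_succ, Fin.cons_zero, Fin.cons_succ] using this
    · intro a b
      refine Fin.cases ?_ (fun a => ?_) a <;> refine Fin.cases ?_ (fun b => ?_) b
      · simp
      · intro _; simpa using fun h => (hne b).1 (hS.symm _ _ h)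
      · intro _; simpa using (hne a).1
      · intro hab; simpa using hxE a b (by simpa using hab)
    · intro a b
      refine Fin.cases ?_ (fun a => ?_) a <;> refine Fin.cases ?_ (fun b => ?_) b
      · simp
      · intro _; simpa [S.d_symm c j] using (hne b).2
      · intro _; simpa using (hne a).2
      · intro hab; simpa using hxd a b (by simpa using hab)
  · refine le_trans (le_of_eq (sum_congr rfl fun l _ => ?_)) ((hS.mono hζ).sum_pow_le j hjT)
    rw [← S.d_add c (col j) j l hjc.symm, add_sub_cancel_left]
  · intro a
    rw [← S.dist_eq]
    exact (hxt a).trans ht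

/-- If the points of a clique of color `c` all have a color `col` other than `c`, then their
densities are close to `1/2`: the two bounds of `IsBookBounded` add up to the equality case of
`le_bookFun`. -/
lemma dist_le_of_clique {k : ℕ} (hk : 2 ≤ k) {η : ℝ} (hη : 0 < η) :
    ∃ ζ > 0, ∀ (ι : Type) [Fintype ι] (S : WeightedColoring ι) (δ : ℝ) (E : ι → ι → Prop)
      (T : ι → Prop) (col : ι → Fin 2), S.IsBookBounded k δ ζ E T col →
      ∀ (c : Fin 2) (x : Fin k → ι), (∀ a, T (x a) ∧ col (x a) ≠ c) →
      (∀ a b, a ≠ b → ¬ E (x a) (x b)) → (∀ a b, a ≠ b → δ ≤ S.d c (x a) (x b)) →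
      ∀ a, S.dist (x a) ≤ η := by
  obtain ⟨ζ₁, hζ₁, hpow⟩ := average_pow_stability hk hη
  have hk0 : (0 : ℝ) < k := by exact_mod_cast (by omega : 0 < k)
  obtain ⟨ζ₂, hζ₂, hbook⟩ := average_bookFun_stability hk (half_pos hζ₁)
  refine ⟨min (min ζ₁ ζ₂) (ζ₁ / (2 * k * 2 ^ k)), by positivity,
    fun ι _ S δ E T col hS c x hxT hxE hxd a => ?_⟩
  set ζ := min (min ζ₁ ζ₂) (ζ₁ / (2 * k * 2 ^ k)) with hζ
  have hζ0 : 0 < ζ := by positivity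
  have h1 : ζ ≤ ζ₁ := (min_le_left _ _).trans (min_le_left _ _)
  have h2 : ζ ≤ ζ₂ := (min_le_left _ _).trans (min_le_right _ _)
  have h3 : k * (2 ^ k * ζ) ≤ ζ₁ / 2 := by
    calc k * (2 ^ k * ζ) ≤ k * (2 ^ k * (ζ₁ / (2 * k * 2 ^ k))) := by
          gcongr; exact min_le_right _ _
      _ = ζ₁ / 2 := by field_simp
  have hpow' : ∀ a, ∑ j, S.w j * (1 - S.d c (x a) j) ^ k ≤ (1 / 2) ^ k + ζ := fun a => by
    refine le_trans (le_of_eq (sum_congr rfl fun l _ => ?_)) (hS.sum_pow_le _ (hxT a).1)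
    rw [← S.d_add c (col (x a)) (x a) l (hxT a).2.symm, add_sub_cancel_left]
  have hmean : ∀ a, 1 / 2 - 2 ^ k * ζ ≤ ∑ j, S.w j * S.d c (x a) j := fun a => by
    have := average_le_of_average_pow_le hk S.w_nonneg S.sum_w
      (fun j => by linarith [S.d_le_one c (x a) j]) hζ0.le (hpow' a)
    simp only [mul_sub, mul_one, sum_sub_distrib, S.sum_w] at this
    linarith
  have hB := hbook ι S.w (fun a => S.d c (x a)) S.w_nonneg S.sum_w
    (fun a l => ⟨S.d_nonneg _ _ _, S.d_le_one _ _ _⟩)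
    ((hS.sum_prod_le c x (fun a => (hxT a).1) hxE hxd).trans (by linarith))
    (fun a => (hpow' a).trans (by linarith))
  have hsum : ∑ a, ∑ j, S.w j * S.d c (x a) j ≤ k / 2 + ζ₁ / 2 := by
    have : ∑ a, ∑ j, S.w j * S.d c (x a) j - k / 2
        = ∑ j, S.w j * (∑ a, S.d c (x a) j - k / 2) := by
      rw [sum_comm]
      simp only [mul_sub, sum_sub_distrib, ← sum_mul, S.sum_w, mul_sum, one_mul]
    have h4 : ∑ j, S.w j * (∑ a, S.d c (x a) j - k / 2) ≤ ζ₁ / 2 :=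
      (sum_le_sum fun j _ => mul_le_mul_of_nonneg_left (le_abs_self _) (S.w_nonneg j)).trans hB
    linarith
  have hone : ∑ j, S.w j * S.d c (x a) j ≤ 1 / 2 + ζ₁ := by
    have h5 : ∑ b ∈ univ.erase a, (1 / 2 - 2 ^ k * ζ)
        ≤ ∑ b ∈ univ.erase a, ∑ j, S.w j * S.d c (x b) j := sum_le_sum fun b _ => hmean b
    rw [← add_sum_erase _ _ (mem_univ a)] at hsum
    rw [sum_const, card_erase_of_mem (mem_univ a), card_univ, Fintype.card_fin, nsmul_eq_mul,
      Nat.cast_sub (by omega)] at h5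
    push_cast at h5
    nlinarith [show 0 ≤ 2 ^ k * ζ by positivity]
  rw [S.dist_eq (col (x a))]
  have e : ∀ j, S.d (col (x a)) (x a) j = 1 - S.d c (x a) j := fun j => by
    linarith [S.d_add c (col (x a)) (x a) j (hxT a).2.symm]
  refine hpow ι S.w _ S.w_nonneg S.sum_w (fun j => S.d_nonneg _ _ _) ?_ ?_
  · exact (hS.sum_pow_le _ (hxT a).1).trans (by linarith)
  · simp only [e, mul_sub, mul_one, sum_sub_distrib, S.sum_w]
    linarith

/-- For `δ` and `ζ` small, the greedy choice of a `δ`-dense clique of `n + 1` points fits into half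
of the total weight. -/
lemma exists_greedy_threshold (n : ℕ) : ∃ t : ℝ, 0 < t ∧ t ≤ 1 / 4 ∧
    n * (((1 / 2) ^ (n + 1) + t) / (1 - t) ^ (n + 1) + t) < (1 - t) / 2 := by
  have hcont : ContinuousAt (fun t : ℝ => (1 - t) / 2
      - n * (((1 / 2) ^ (n + 1) + t) / (1 - t) ^ (n + 1) + t)) 0 := by
    refine ContinuousAt.sub (by fun_prop) (ContinuousAt.mul (by fun_prop) (ContinuousAt.add
      (ContinuousAt.div (by fun_prop) (by fun_prop) (by norm_num)) (by fun_prop)))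
  have h0 : (0 : ℝ) < (1 - 0) / 2 - n * (((1 / 2) ^ (n + 1) + 0) / (1 - 0) ^ (n + 1) + 0) := by
    have h1 : (n : ℝ) < 2 ^ n := by exact_mod_cast Nat.lt_two_pow_self
    have h2 : (n : ℝ) * (1 / 2) ^ n < 1 := by
      have : (2 : ℝ) ^ n * (1 / 2) ^ n = 1 := by rw [← mul_pow]; norm_num
      exact (mul_lt_mul_of_pos_right h1 (by positivity)).trans_eq this
    simp only [sub_zero, one_pow, add_zero, pow_succ]
    linarith
  have hev := (hcont.eventually (lt_mem_nhds h0)).filter_mono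
    (nhdsWithin_le_nhds (s := Set.Ioi 0))
  obtain ⟨t, ht, ht0, ht1⟩ := (hev.and (Ioc_mem_nhdsGT (show (0 : ℝ) < 1 / 4 by norm_num))).exists
  exact ⟨t, ht0, ht1, by linarith⟩

/-- If a point `i` satisfies the moment bound in its color, few points have small density to it in
the other color. -/
lemma wt_sparse_le {k : ℕ} {δ ζ : ℝ} {E : ι → ι → Prop} {T : ι → Prop} {col : ι → Fin 2}
    (hS : S.IsBookBounded k δ ζ E T col) (hδ : δ < 1) {c : Fin 2} {i : ι} (hi : T i)
    (hc : col i ≠ c) :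
    S.wt (fun j => S.d c i j < δ) ≤ ((1 / 2) ^ k + ζ) / (1 - δ) ^ k := by
  rw [le_div_iff₀ (pow_pos (by linarith) _), mul_comm]
  refine (S.mul_wt_le (f := fun j => S.d (col i) i j ^ k)
    (fun j => pow_nonneg (S.d_nonneg _ _ _) _) fun j hj => ?_).trans (hS.sum_pow_le i hi)
  exact pow_le_pow_left₀ (by linarith) (by linarith [S.d_add (col i) c i j hc]) _

/-- A weighted coloring satisfying the book bounds has almost all densities close to `1/2`. -/
theorem IsBookBounded.sum_dist_le {k : ℕ} (hk : 2 ≤ k) {η : ℝ} (hη : 0 < η) :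
    ∃ δ > 0, ∃ ζ > 0, ∀ (ι : Type) [Fintype ι] (S : WeightedColoring ι) (E : ι → ι → Prop)
      (T : ι → Prop) (col : ι → Fin 2), S.IsBookBounded k δ ζ E T col →
      ∑ i, S.w i * S.dist i ≤ η := by
  obtain ⟨n, rfl⟩ : ∃ n, k = n + 1 := ⟨k - 1, by omega⟩
  have hn : 1 ≤ n := by omega
  obtain ⟨δ, hδ0, hδ, hgreedy⟩ := exists_greedy_threshold n
  set s : ℝ := min η 1 / (64 * (n + 1)) with hs
  have hs0 : 0 < s := by positivity
  have hns : (n + 1) * s = min η 1 / 64 := by rw [hs]; field_simp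
  obtain ⟨ζ₄, hζ₄, hfar₄⟩ := wt_far_le hn (show 0 < η / 4 by positivity)
  obtain ⟨η₃, hη₃, hη₃4, hη₃s⟩ : ∃ t > 0, t ≤ ζ₄ ∧ t ≤ s :=
    ⟨min ζ₄ s, by positivity, min_le_left _ _, min_le_right _ _⟩
  obtain ⟨ζ₃, hζ₃, hfar₃⟩ := wt_far_le hn hη₃
  obtain ⟨η₂, hη₂, hη₂3, hη₂s⟩ : ∃ t > 0, t ≤ ζ₃ ∧ t ≤ s :=
    ⟨min ζ₃ s, by positivity, min_le_left _ _, min_le_right _ _⟩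
  obtain ⟨ζ₂, hζ₂, hclique⟩ := dist_le_of_clique hk hη₂
  obtain ⟨ζ, hζ, hζδ, hζs, hζ2, hζ3, hζ4⟩ : ∃ t > 0, t ≤ δ ∧ t ≤ s ∧ t ≤ ζ₂ ∧ t ≤ ζ₃ ∧ t ≤ ζ₄ := by
    refine ⟨min δ (min s (min ζ₂ (min ζ₃ ζ₄))), by positivity, ?_, ?_, ?_, ?_, ?_⟩ <;> simp
  refine ⟨δ, hδ0, ζ, hζ, fun ι _ S E T col hS => ?_⟩
  have hmin1 : min η 1 ≤ 1 := min_le_right _ _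
  have hminη : min η 1 ≤ η := min_le_left _ _
  have hn0 : (0 : ℝ) ≤ n := Nat.cast_nonneg n
  have hns' : n * s ≤ min η 1 / 64 := by linarith
  have hs1 : s ≤ min η 1 / 64 := by nlinarith
  have hnζ : n * ζ ≤ n * s := mul_le_mul_of_nonneg_left hζs hn0
  have hnη₂ : n * η₂ ≤ n * s := mul_le_mul_of_nonneg_left hη₂s hn0
  have hnη₃ : n * η₃ ≤ n * s := mul_le_mul_of_nonneg_left hη₃s hn0
  -- `c` is the color such that the typical points of the other color carry half of the weight
  obtain ⟨c, hc⟩ : ∃ c, (1 - ζ) / 2 ≤ S.wt (fun i => T i ∧ col i ≠ c) := by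
    by_contra! hcon
    have h1 : (1 : ℝ) ≤ S.wt (fun i => ¬ T i)
        + S.wt (fun i => (T i ∧ col i ≠ 0) ∨ (T i ∧ col i ≠ 1)) := by
      rw [← S.wt_true]
      refine (S.wt_mono fun i _ => ?_).trans (S.wt_or_le _ _)
      by_cases hT : T i
      · right
        by_cases h0 : col i = 0
        · right; rw [h0]; exact ⟨hT, by decide⟩
        · left; exact ⟨hT, h0⟩
      · exact Or.inl hT
    have h2 := S.wt_or_le (fun i => T i ∧ col i ≠ 0) (fun i => T i ∧ col i ≠ 1)
    linarith [hcon 0, hcon 1, hS.wt_atypical]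
  obtain ⟨c', hc'⟩ := exists_ne c
  -- a clique in color `c` of points whose parts are rich in the other color
  obtain ⟨x, hxT, hxx⟩ := S.exists_pairwise_not (R := fun i => T i ∧ col i ≠ c)
    (bad := fun i j => E i j ∨ S.d c i j < δ)
    (fun i j h => h.imp (hS.symm i j) fun h => by rwa [S.d_symm])
    (t := ((1 / 2) ^ (n + 1) + δ) / (1 - δ) ^ (n + 1) + δ)
    (by have : 0 < 1 - δ := by linarith
        positivity)
    (fun i hi => by
      refine (S.wt_or_le _ _).trans ?_
      have := (S.wt_sparse_le (hS.mono hζδ) (by linarith) hi.1 hi.2)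
      linarith [hS.wt_exceptional i hi.1]) n (by linarith)
  simp only [not_or, not_lt] at hxx
  have hxd := hclique ι S δ E T col (hS.mono hζ2) c x hxT (fun a b h => (hxx a b h).1)
    fun a b h => (hxx a b h).2
  have hfar := hfar₃ ι S δ ζ E T col hS hζ3 hδ c (Fin.tail x) η₂ hη₂3 (fun a => (hxT _).1)
    (fun a b h => (hxx _ _ (by simpa using h)).1) (fun a b h => (hxx _ _ (by simpa using h)).2)
    fun a => hxd _
  -- almost all points of that kind are close to `1/2`, so there is a clique of them in color `c'`
  have hclose : (1 - ζ) / 2 - n * (ζ + 4 * η₂)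
      ≤ S.wt (fun j => T j ∧ col j ≠ c ∧ S.dist j ≤ η₃) := by
    have h1 := (S.wt_mono (P := fun j => T j ∧ col j ≠ c)
      (Q := fun j => (T j ∧ col j ≠ c ∧ S.dist j ≤ η₃) ∨ (T j ∧ col j ≠ c ∧ η₃ < S.dist j))
      (fun j hj => (le_or_gt (S.dist j) η₃).imp (fun h => ⟨hj.1, hj.2, h⟩)
        fun h => ⟨hj.1, hj.2, h⟩)).trans (S.wt_or_le _ _)
    linarith
  obtain ⟨y, hyT, hyy⟩ := S.exists_pairwise_not (R := fun j => T j ∧ col j ≠ c ∧ S.dist j ≤ η₃)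
    (bad := fun i j => E i j ∨ S.d c' i j < δ)
    (fun i j h => h.imp (hS.symm i j) fun h => by rwa [S.d_symm])
    (t := ζ + 4 * η₃) (by positivity)
    (fun i hi => by
      refine (S.wt_or_le _ _).trans (add_le_add (hS.wt_exceptional i hi.1) ?_)
      exact (S.wt_density_lt_le hδ c' i).trans (by linarith [hi.2.2])) n (by linarith)
  simp only [not_or, not_lt] at hyy
  have hfar' := hfar₄ ι S δ ζ E T col hS hζ4 hδ c' (Fin.tail y) η₃ hη₃4 (fun a => (hyT _).1)
    (fun a b h => (hyy _ _ (by simpa using h)).1) (fun a b h => (hyy _ _ (by simpa using h)).2)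
    fun a => (hyT _).2.2
  have hall : S.wt (fun j => η / 4 < S.dist j) ≤ ζ + (n * (ζ + 4 * η₂) + n * (ζ + 4 * η₃)) := by
    refine (S.wt_mono (Q := fun j => ¬ T j ∨ ((T j ∧ col j ≠ c ∧ η₃ < S.dist j) ∨
      (T j ∧ col j ≠ c' ∧ η / 4 < S.dist j))) fun j hj => ?_).trans
      ((S.wt_or_le _ _).trans (add_le_add hS.wt_atypical
        ((S.wt_or_le _ _).trans (add_le_add hfar hfar'))))
    by_cases hT : T j
    · right
      by_cases hjc : col j = c
      · exact Or.inr ⟨hT, hjc ▸ hc'.symm, hj⟩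
      · exact Or.inl ⟨hT, hjc, by linarith⟩
    · exact Or.inl hT
  have hfinal : ∑ i, S.w i * S.dist i ≤ η / 4 + S.wt (fun j => η / 4 < S.dist j) := by
    have e : η / 4 = ∑ i, S.w i * (η / 4) := by rw [← sum_mul, S.sum_w, one_mul]
    refine le_of_le_of_eq ?_ (congrArg (· + _) e.symm)
    simp only [wt]
    rw [← sum_add_distrib]
    refine sum_le_sum fun i _ => ?_
    have h1 := S.w_nonneg i
    split_ifs with h
    · nlinarith [S.dist_le_one i, mul_nonneg hη.le h1]
    · push Not at h
      nlinarith
  linarith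

end WeightedColoring

/-! ### Counting cliques and common neighbors -/

section Counting

variable {α : Type} (G : SimpleGraph α) [DecidableRel G.Adj]

/-- The vertices of `V` adjacent to all entries of the tuple `x`. -/
def commonNbrs {k : ℕ} (x : Fin k → α) (V : Finset α) : Finset α := {y ∈ V | ∀ a, G.Adj (x a) y}

/-- The tuples of pairwise adjacent vertices with `a`-th entry in `U a`. -/
def cliqueTuples {k : ℕ} (U : Fin k → Finset α) : Finset (Fin k → α) :=
  {x ∈ Fintype.piFinset U | ∀ a b, a ≠ b → G.Adj (x a) (x b)}

variable {G}

lemma mem_commonNbrs {k : ℕ} {x : Fin k → α} {V : Finset α} {y : α} :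
    y ∈ commonNbrs G x V ↔ y ∈ V ∧ ∀ a, G.Adj (x a) y := by
  simp [commonNbrs]

lemma mem_cliqueTuples {k : ℕ} {U : Fin k → Finset α} {x : Fin k → α} :
    x ∈ cliqueTuples G U ↔ (∀ a, x a ∈ U a) ∧ ∀ a b, a ≠ b → G.Adj (x a) (x b) := by
  simp [cliqueTuples]

lemma cliqueTuples_subset {k : ℕ} (U : Fin k → Finset α) :
    cliqueTuples G U ⊆ Fintype.piFinset U := filter_subset _ _

lemma cons_mem_cliqueTuples {k : ℕ} {U : Fin (k + 1) → Finset α} {v : α} {x : Fin k → α} :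
    (Fin.cons v x : Fin (k + 1) → α) ∈ cliqueTuples G U ↔
      x ∈ cliqueTuples G (Fin.tail U) ∧ v ∈ commonNbrs G x (U 0) := by
  simp only [mem_cliqueTuples, mem_commonNbrs, Fin.forall_fin_succ, Fin.cons_zero, Fin.cons_succ,
    Fin.tail, ne_eq, not_true_eq_false, false_imp_iff, true_and, Fin.succ_ne_zero,
    (Fin.succ_ne_zero _).symm, not_false_eq_true, true_imp_iff, Fin.succ_inj]
  constructor
  · rintro ⟨⟨h1, h2⟩, h3, h4⟩
    exact ⟨⟨h2, fun a b => (h4 a).2 b⟩, h1, fun a => (h4 a).1⟩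
  · rintro ⟨⟨h2, h5⟩, h1, h4⟩
    exact ⟨⟨h1, h2⟩, fun a => (h4 a).symm, fun a => ⟨h4 a, h5 a⟩⟩

lemma edgeDensity_mul_card (X Y : Finset α) :
    (G.edgeDensity X Y : ℝ) * (#X * #Y) = #(G.interedges X Y) := by
  rcases X.eq_empty_or_nonempty with rfl | hX
  · simp
  rcases Y.eq_empty_or_nonempty with rfl | hY
  · have h := G.card_interedges_le_mul X ∅
    simp only [card_empty, mul_zero, nonpos_iff_eq_zero] at h
    rw [h]; simp
  have hX' : (0 : ℝ) < #X := by exact_mod_cast hX.card_pos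
  have hY' : (0 : ℝ) < #Y := by exact_mod_cast hY.card_pos
  rw [SimpleGraph.edgeDensity_def]
  push_cast
  field_simp

lemma card_interedges_eq_sum (X Y : Finset α) :
    #(G.interedges X Y) = ∑ v ∈ X, #{y ∈ Y | G.Adj v y} := by
  rw [SimpleGraph.interedges_def, card_filter, sum_product]
  simp only [card_filter]

/-- In a uniform pair few vertices have much fewer neighbors than expected in a given subset. -/
lemma card_low_degree_le {ε : ℝ} {U V Y : Finset α} (h : G.IsUniform ε U V) (hY : Y ⊆ V) :
    (#{v ∈ U | (#{y ∈ Y | G.Adj v y} : ℝ) < G.edgeDensity U V * #Y - ε * #V} : ℝ) ≤ ε * #U := by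
  set d : ℝ := (G.edgeDensity U V : ℝ) with hd
  set X := {v ∈ U | (#{y ∈ Y | G.Adj v y} : ℝ) < d * #Y - ε * #V} with hX
  by_contra hcon
  push Not at hcon
  have hε := h.pos
  have hXpos : (0 : ℝ) < #X := lt_of_le_of_lt (by positivity) hcon
  obtain ⟨v, hv⟩ : X.Nonempty := card_pos.1 (by exact_mod_cast hXpos)
  have hd0 : 0 ≤ d := by rw [hd]; exact_mod_cast G.edgeDensity_nonneg U V
  have hd1 : d ≤ 1 := by rw [hd]; exact_mod_cast G.edgeDensity_le_one U V
  have hv' := (mem_filter.1 hv).2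
  have hYpos : (0 : ℝ) ≤ #Y := Nat.cast_nonneg _
  have hYV : (#Y : ℝ) ≤ #V := by exact_mod_cast card_le_card hY
  have hlow : ε * #V < d * #Y := by
    have : (0 : ℝ) ≤ #{y ∈ Y | G.Adj v y} := Nat.cast_nonneg _
    linarith
  have hVY : (#V : ℝ) * ε ≤ #Y := by nlinarith
  have hY0 : (0 : ℝ) < #Y := by
    rcases hYpos.eq_or_lt with h0 | h0
    · rw [← h0, mul_zero] at hlow
      have : 0 ≤ ε * (#V : ℝ) := by positivity
      linarith
    · exact h0
  have hunif := h (filter_subset _ U : X ⊆ U) hY (by linarith) hVY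
  have h1 := (abs_lt.1 hunif).1
  have h2 : (#(G.interedges X Y) : ℝ) ≤ #X * (d * #Y - ε * #V) := by
    rw [card_interedges_eq_sum]
    push_cast
    rw [← nsmul_eq_mul]
    exact sum_le_card_nsmul _ _ _ fun v hv => (mem_filter.1 hv).2.le
  rw [← edgeDensity_mul_card] at h2
  have h3 : (d - ε) * (#X * #Y) < G.edgeDensity X Y * (#X * #Y) :=
    mul_lt_mul_of_pos_right (by linarith) (by positivity)
  have h4 : (#X : ℝ) * (ε * #Y) ≤ #X * (ε * #V) := by gcongr
  linarith

variable [Fintype α] [DecidableEq α]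

lemma card_eq_sum_card_cons {k : ℕ} {s : Finset (Fin (k + 1) → α)} {t : Finset (Fin k → α)}
    (h : ∀ z ∈ s, Fin.tail z ∈ t) :
    #s = ∑ x ∈ t, #{v | (Fin.cons v x : Fin (k + 1) → α) ∈ s} := by
  rw [card_eq_sum_card_fiberwise (f := Fin.tail) h]
  refine sum_congr rfl fun x _ => ?_
  refine card_nbij' (fun z => z 0) (fun v => Fin.cons v x) ?_ ?_ ?_ ?_
  · rintro z hz
    simp only [coe_filter, Set.mem_ofPred_eq, mem_univ, true_and] at hz ⊢
    rw [← hz.2, Fin.cons_self_tail]; exact hz.1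
  · rintro v hv
    simp only [coe_filter, Set.mem_ofPred_eq, mem_univ, true_and, Fin.tail_cons, and_true] at hv ⊢
    exact hv
  · rintro z hz
    simp only [coe_filter, Set.mem_ofPred_eq] at hz ⊢
    rw [← hz.2, Fin.cons_self_tail]
  · rintro v hv
    simp

lemma card_eq_sum_card_cons' {k : ℕ} {s : Finset (Fin (k + 1) → α)} {t : Finset α}
    (h : ∀ z ∈ s, z 0 ∈ t) :
    #s = ∑ v ∈ t, #{x | (Fin.cons v x : Fin (k + 1) → α) ∈ s} := by
  rw [card_eq_sum_card_fiberwise (f := fun z : Fin (k + 1) → α => z 0) (t := t)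
    fun z hz => h z hz]
  refine sum_congr rfl fun v _ => ?_
  refine card_nbij' Fin.tail (fun x => Fin.cons v x) ?_ ?_ ?_ ?_
  · rintro z hz
    simp only [coe_filter, Set.mem_ofPred_eq, mem_univ, true_and] at hz ⊢
    rw [← hz.2, Fin.cons_self_tail]; exact hz.1
  · rintro x hx
    simp only [coe_filter, Set.mem_ofPred_eq, mem_univ, true_and, Fin.cons_zero, and_true] at hx ⊢
    exact hx
  · rintro z hz
    simp only [coe_filter, Set.mem_ofPred_eq] at hz ⊢
    rw [← hz.2, Fin.cons_self_tail]
  · rintro x hx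
    simp

lemma card_cliqueTuples_succ {k : ℕ} (U : Fin (k + 1) → Finset α) :
    #(cliqueTuples G U) = ∑ x ∈ cliqueTuples G (Fin.tail U), #(commonNbrs G x (U 0)) := by
  rw [card_eq_sum_card_cons (t := cliqueTuples G (Fin.tail U))]
  · refine sum_congr rfl fun x hx => ?_
    congr 1
    ext v
    simp [cons_mem_cliqueTuples, hx]
  · intro z hz
    rw [← Fin.cons_self_tail z, cons_mem_cliqueTuples] at hz
    exact hz.1

lemma card_cliqueTuples_succ' {k : ℕ} (W : Finset α) :
    #(cliqueTuples G fun _ : Fin (k + 1) => W)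
      = ∑ v ∈ W, #(cliqueTuples G fun _ : Fin k => {y ∈ W | G.Adj v y}) := by
  rw [card_eq_sum_card_cons' (t := W)]
  · refine sum_congr rfl fun v hv => ?_
    congr 1
    ext x
    simp only [mem_filter, mem_univ, true_and]
    rw [cons_mem_cliqueTuples]
    simp only [mem_filter, mem_cliqueTuples, mem_commonNbrs, hv, true_and, Fin.tail]
    constructor
    · rintro ⟨⟨h1, h2⟩, h3⟩
      exact ⟨fun a => ⟨h1 a, (h3 a).symm⟩, h2⟩
    · rintro ⟨h1, h2⟩
      exact ⟨⟨fun a => (h1 a).1, h2⟩, fun a => (h1 a).2.symm⟩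
  · intro z hz
    exact (mem_cliqueTuples.1 hz).1 0

/-- All but an `ε k` fraction of the tuples in `∏ U a` have about at least the expected number of
common neighbors in `V`, if the pairs `(U a, V)` are uniform. -/
lemma card_low_codegree_le {ε : ℝ} (hε : 0 ≤ ε) {V : Finset α} {k : ℕ} {U : Fin k → Finset α}
    (hU : ∀ a, G.IsUniform ε (U a) V) :
    (#{x ∈ Fintype.piFinset U | (#(commonNbrs G x V) : ℝ) <
      (∏ a, (G.edgeDensity (U a) V : ℝ) - k * ε) * #V} : ℝ) ≤ k * ε * ∏ a, (#(U a) : ℝ) := by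
  induction k with
  | zero =>
    have : ∀ x : Fin 0 → α, commonNbrs G x V = V := fun x => by simp [commonNbrs]
    simp [this]
  | succ k ih =>
    have ih' := ih (U := Fin.tail U) fun a => hU a.succ
    set bad := {x ∈ Fintype.piFinset (Fin.tail U) | (#(commonNbrs G x V) : ℝ) <
      (∏ a, (G.edgeDensity (Fin.tail U a) V : ℝ) - k * ε) * #V} with hbad
    set P := ∏ a, (#(Fin.tail U a) : ℝ) with hP
    have hP' : (#(Fintype.piFinset (Fin.tail U)) : ℝ) = P := by
      rw [Fintype.card_piFinset]; push_cast; rfl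
    rw [card_eq_sum_card_cons (t := Fintype.piFinset (Fin.tail U))]
    swap
    · intro z hz
      have := Fintype.mem_piFinset.1 (mem_filter.1 hz).1
      exact Fintype.mem_piFinset.2 fun a => this a.succ
    push_cast
    have hpt : ∀ x ∈ Fintype.piFinset (Fin.tail U),
        (#{v | (Fin.cons v x : Fin (k + 1) → α) ∈ {z ∈ Fintype.piFinset U |
          (#(commonNbrs G z V) : ℝ) < (∏ a, (G.edgeDensity (U a) V : ℝ) - (k + 1) * ε) * #V}} : ℝ)
        ≤ (if x ∈ bad then (#(U 0) : ℝ) else 0) + ε * #(U 0) := by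
      intro x hx
      by_cases hxb : x ∈ bad
      · rw [if_pos hxb]
        have : #{v | (Fin.cons v x : Fin (k + 1) → α) ∈ {z ∈ Fintype.piFinset U |
          (#(commonNbrs G z V) : ℝ) < (∏ a, (G.edgeDensity (U a) V : ℝ) - (k + 1) * ε) * #V}}
          ≤ #(U 0) := by
          refine card_le_card fun v hv => ?_
          simp only [mem_filter, mem_univ, true_and, Fintype.mem_piFinset] at hv
          simpa using hv.1 0
        have h2 : (0 : ℝ) ≤ ε * #(U 0) := by positivity
        have h3 : (_ : ℝ) ≤ #(U 0) := Nat.cast_le.2 this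
        linarith
      · rw [if_neg hxb, zero_add]
        refine le_trans ?_ (card_low_degree_le (hU 0) (Y := commonNbrs G x V)
          (filter_subset _ V))
        refine Nat.cast_le.2 (card_le_card fun v hv => ?_)
        simp only [mem_filter, mem_univ, true_and, Fintype.mem_piFinset] at hv ⊢
        refine ⟨by simpa using hv.1 0, ?_⟩
        have e : commonNbrs G (Fin.cons v x : Fin (k + 1) → α) V
            = {y ∈ commonNbrs G x V | G.Adj v y} := by
          ext y
          simp only [mem_commonNbrs, Fin.forall_fin_succ, Fin.cons_zero, Fin.cons_succ, mem_filter]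
          tauto
        rw [← e]
        refine hv.2.trans_le ?_
        have hx' : (∏ a, (G.edgeDensity (Fin.tail U a) V : ℝ) - k * ε) * #V
            ≤ #(commonNbrs G x V) := by
          by_contra hc
          exact hxb (mem_filter.2 ⟨hx, not_le.1 hc⟩)
        have hd0 : (0 : ℝ) ≤ G.edgeDensity (U 0) V := by exact_mod_cast G.edgeDensity_nonneg _ _
        have hd1 : (G.edgeDensity (U 0) V : ℝ) ≤ 1 := by exact_mod_cast G.edgeDensity_le_one _ _
        rw [Fin.prod_univ_succ]
        have h5 := mul_le_mul_of_nonneg_left hx' hd0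
        have h6 : (G.edgeDensity (U 0) V : ℝ) * (k * ε * #V) ≤ k * ε * #V :=
          mul_le_of_le_one_left (by positivity) hd1
        simp only [Fin.tail] at h5
        linarith
    refine (sum_le_sum hpt).trans ?_
    rw [sum_add_distrib, sum_const, nsmul_eq_mul, hP', Fin.prod_univ_succ,
      ← sum_filter, sum_const, nsmul_eq_mul, filter_mem_eq_inter,
      inter_eq_right.2 (filter_subset _ _ : bad ⊆ _)]
    have h7 := mul_le_mul_of_nonneg_right ih' (show (0 : ℝ) ≤ #(U 0) by positivity)
    have e : ∏ i : Fin k, (#(U i.succ) : ℝ) = P := rfl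
    rw [e]
    linarith

/-- The number of pairs of a tuple in `T` and a common neighbor of it in `V` is about at least the
number expected from the densities. -/
lemma le_sum_card_commonNbrs {ε : ℝ} (hε : 0 ≤ ε) {V : Finset α} {k : ℕ} {U : Fin k → Finset α}
    (hU : ∀ a, G.IsUniform ε (U a) V) {T : Finset (Fin k → α)} (hT : T ⊆ Fintype.piFinset U) :
    #T * ((∏ a, (G.edgeDensity (U a) V : ℝ) - k * ε) * #V) - k * ε * (∏ a, (#(U a) : ℝ)) * #V
      ≤ ∑ x ∈ T, (#(commonNbrs G x V) : ℝ) := by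
  set D := (∏ a, (G.edgeDensity (U a) V : ℝ) - k * ε) * #V with hD
  set bad := {x ∈ Fintype.piFinset U | (#(commonNbrs G x V) : ℝ) < D} with hbad
  have hDV : D ≤ #V := by
    have : ∏ a, (G.edgeDensity (U a) V : ℝ) ≤ 1 := prod_le_one
      (fun a _ => by exact_mod_cast G.edgeDensity_nonneg _ _)
      (fun a _ => by exact_mod_cast G.edgeDensity_le_one _ _)
    refine mul_le_of_le_one_left (by positivity) ?_
    have : 0 ≤ k * ε := by positivity
    linarith
  have hpt : ∀ x ∈ T, D - (if x ∈ bad then (#V : ℝ) else 0) ≤ #(commonNbrs G x V) := by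
    intro x hx
    have h0 : (0 : ℝ) ≤ #(commonNbrs G x V) := by positivity
    split_ifs with hb
    · linarith
    · rw [sub_zero]
      by_contra hc
      exact hb (mem_filter.2 ⟨hT hx, not_le.1 hc⟩)
  refine le_trans ?_ (sum_le_sum hpt)
  rw [sum_sub_distrib, sum_const, nsmul_eq_mul, ← sum_filter, sum_const, nsmul_eq_mul,
    filter_mem_eq_inter]
  have h1 : (#(T ∩ bad) : ℝ) ≤ k * ε * ∏ a, (#(U a) : ℝ) :=
    (Nat.cast_le.2 (card_le_card inter_subset_right)).trans (card_low_codegree_le hε hU)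
  have h2 := mul_le_mul_of_nonneg_right h1 (show (0 : ℝ) ≤ #V by positivity)
  linarith

end Counting

/-- The counting lemma for cliques. -/
lemma exists_le_card_cliqueTuples (k : ℕ) {δ : ℝ} (hδ : 0 < δ) :
    ∃ κ > 0, ∃ ε₀ > 0, ∀ (α : Type) [Fintype α] [DecidableEq α] (G : SimpleGraph α)
      [DecidableRel G.Adj] (ε : ℝ) (U : Fin k → Finset α), 0 ≤ ε → ε ≤ ε₀ →
      (∀ a b, a ≠ b → G.IsUniform ε (U a) (U b)) →
      (∀ a b, a ≠ b → δ ≤ (G.edgeDensity (U a) (U b) : ℝ)) →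
      κ * ∏ a, (#(U a) : ℝ) ≤ #(cliqueTuples G U) := by
  induction k with
  | zero =>
    refine ⟨1, one_pos, 1, one_pos, fun α _ _ G _ ε U _ _ _ _ => ?_⟩
    have : (cliqueTuples G U).Nonempty :=
      ⟨fun a => a.elim0, mem_cliqueTuples.2 ⟨fun a => a.elim0, fun a => a.elim0⟩⟩
    simpa using this.card_pos
  | succ k ih =>
    obtain ⟨κ, hκ, ε₀, hε₀, ih⟩ := ih
    refine ⟨κ * δ ^ k / 4, by positivity,
      min ε₀ (min (κ * δ ^ k / (4 * (k + 1))) (δ ^ k / (2 * (k + 1)))),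
      by positivity, fun α _ _ G _ ε U hε0 hε hU hd => ?_⟩
    have hε1 : ε ≤ ε₀ := hε.trans (min_le_left _ _)
    have hε2 : ε ≤ κ * δ ^ k / (4 * (k + 1)) :=
      hε.trans ((min_le_right _ _).trans (min_le_left _ _))
    have hε3 : ε ≤ δ ^ k / (2 * (k + 1)) := hε.trans ((min_le_right _ _).trans (min_le_right _ _))
    rw [le_div_iff₀ (by positivity)] at hε2 hε3
    have ih' := ih α G ε (Fin.tail U) hε0 hε1 (fun a b h => hU _ _ (by simpa using h))
      fun a b h => hd _ _ (by simpa using h)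
    have hsum := le_sum_card_commonNbrs (U := Fin.tail U) (V := U 0) hε0
      (fun a => hU _ _ (Fin.succ_ne_zero a)) (cliqueTuples_subset (G := G) _)
    rw [card_cliqueTuples_succ, Fin.prod_univ_succ]
    push_cast
    refine le_trans ?_ hsum
    have hprod : δ ^ k ≤ ∏ a, (G.edgeDensity (Fin.tail U a) (U 0) : ℝ) := by
      have := prod_le_prod (s := univ) (f := fun _ : Fin k => δ)
        (g := fun a => (G.edgeDensity (Fin.tail U a) (U 0) : ℝ)) (fun _ _ => hδ.le)
        (fun a _ => hd _ _ (Fin.succ_ne_zero a))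
      simpa using this
    set Q := ∏ a, (G.edgeDensity (Fin.tail U a) (U 0) : ℝ)
    have hPe : ∏ a, (#(Fin.tail U a) : ℝ) = ∏ a : Fin k, (#(U a.succ) : ℝ) := rfl
    rw [hPe] at ih' ⊢
    set P := ∏ a : Fin k, (#(U a.succ) : ℝ)
    have hP0 : 0 ≤ P := prod_nonneg fun _ _ => Nat.cast_nonneg _
    clear_value P Q
    have hkε : (k : ℝ) * ε ≤ (k + 1) * ε := by linarith
    have hu : (0 : ℝ) ≤ #(U 0) := by positivity
    have hκε : (k : ℝ) * ε ≤ κ * δ ^ k / 4 := by linarith only [hkε, hε2]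
    have hQε : δ ^ k / 2 ≤ Q - k * ε := by linarith only [hkε, hε3, hprod]
    have h1 : κ * P * (δ ^ k / 2) ≤ #(cliqueTuples G (Fin.tail U)) * (Q - k * ε) :=
      mul_le_mul ih' hQε (by positivity) (by positivity)
    have h2 := mul_le_mul_of_nonneg_right h1 hu
    have h3 : k * ε * (P * #(U 0)) ≤ κ * δ ^ k / 4 * (P * #(U 0)) :=
      mul_le_mul_of_nonneg_right hκε (mul_nonneg hP0 hu)
    linarith only [h2, h3]

/-- One step of the Erdős–Szekeres recursion for `exists_le_card_cliqueTuples_or`. -/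
lemma erdosSzekeres_step {α : Type} [Fintype α] [DecidableEq α] {G H : SimpleGraph α}
    [DecidableRel G.Adj] [DecidableRel H.Adj] {κ : ℝ} (hκ : 0 < κ) {n p q : ℕ} {W A : Finset α}
    (hn : 3 * n ≤ #W) (hAW : A ⊆ W) (hA : #W ≤ 2 * #A)
    (hdeg : ∀ v ∈ A, #W ≤ 3 * #{y ∈ W | G.Adj v y})
    (ih : ∀ W' : Finset α, n ≤ #W' →
      κ * (#W' : ℝ) ^ p ≤ #(cliqueTuples G fun _ : Fin p => W') ∨
      κ * (#W' : ℝ) ^ q ≤ #(cliqueTuples H fun _ : Fin q => W')) :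
    κ / (2 * 3 ^ (p + q)) * (#W : ℝ) ^ (p + 1) ≤ #(cliqueTuples G fun _ : Fin (p + 1) => W) ∨
      κ / (2 * 3 ^ (p + q)) * (#W : ℝ) ^ q ≤ #(cliqueTuples H fun _ : Fin q => W) := by
  have hdeg' : ∀ v ∈ A, (#W : ℝ) / 3 ≤ #{y ∈ W | G.Adj v y} := fun v hv => by
    have : (#W : ℝ) ≤ 3 * #{y ∈ W | G.Adj v y} := by exact_mod_cast hdeg v hv
    linarith
  have hpow : ∀ r ≤ p + q, ∀ v ∈ A,
      κ / 3 ^ (p + q) * (#W : ℝ) ^ r ≤ κ * (#{y ∈ W | G.Adj v y} : ℝ) ^ r := by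
    intro r hr v hv
    calc κ / 3 ^ (p + q) * (#W : ℝ) ^ r ≤ κ / 3 ^ r * (#W : ℝ) ^ r := by
          gcongr; norm_num
      _ = κ * ((#W : ℝ) / 3) ^ r := by rw [div_pow]; ring
      _ ≤ _ := by gcongr; exact hdeg' v hv
  by_cases hex : ∃ v ∈ A, κ * (#{y ∈ W | G.Adj v y} : ℝ) ^ q
      ≤ #(cliqueTuples H fun _ : Fin q => {y ∈ W | G.Adj v y})
  · obtain ⟨v, hv, hcl⟩ := hex
    right
    have hsub : #(cliqueTuples H fun _ : Fin q => {y ∈ W | G.Adj v y})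
        ≤ #(cliqueTuples H fun _ : Fin q => W) := by
      refine card_le_card fun x hx => ?_
      rw [mem_cliqueTuples] at hx ⊢
      exact ⟨fun a => (mem_filter.1 (hx.1 a)).1, hx.2⟩
    calc κ / (2 * 3 ^ (p + q)) * (#W : ℝ) ^ q ≤ κ / 3 ^ (p + q) * (#W : ℝ) ^ q := by
          gcongr
          linarith [show (0 : ℝ) < 3 ^ (p + q) by positivity]
      _ ≤ _ := hpow q (by omega) v hv
      _ ≤ _ := hcl
      _ ≤ _ := Nat.cast_le.2 hsub
  · left
    push Not at hex
    rw [card_cliqueTuples_succ']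
    push_cast
    calc κ / (2 * 3 ^ (p + q)) * (#W : ℝ) ^ (p + 1)
        = (#W / 2 : ℝ) * (κ / 3 ^ (p + q) * (#W : ℝ) ^ p) := by ring
      _ ≤ (#A : ℝ) * (κ / 3 ^ (p + q) * (#W : ℝ) ^ p) := by
          gcongr
          have : (#W : ℝ) ≤ 2 * #A := by exact_mod_cast hA
          linarith
      _ ≤ ∑ v ∈ A, (#(cliqueTuples G fun _ : Fin p => {y ∈ W | G.Adj v y}) : ℝ) := by
          rw [← nsmul_eq_mul]
          refine card_nsmul_le_sum _ _ _ fun v hv => (hpow p (by omega) v hv).trans ?_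
          refine (ih _ ?_).resolve_right (hex v hv).not_ge
          have := hdeg v hv
          omega
      _ ≤ _ := sum_le_sum_of_subset_of_nonneg hAW fun _ _ _ => Nat.cast_nonneg _

/-- Ramsey's theorem, in supersaturated form: a positive proportion of all tuples forms cliques in
one of two graphs that together cover all pairs. -/
lemma exists_le_card_cliqueTuples_or (p q : ℕ) :
    ∃ κ > 0, ∃ n : ℕ, ∀ (α : Type) [Fintype α] [DecidableEq α] (G H : SimpleGraph α)
      [DecidableRel G.Adj] [DecidableRel H.Adj], (∀ x y, x ≠ y → G.Adj x y ∨ H.Adj x y) →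
      ∀ W : Finset α, n ≤ #W →
        κ * (#W : ℝ) ^ p ≤ #(cliqueTuples G fun _ : Fin p => W) ∨
        κ * (#W : ℝ) ^ q ≤ #(cliqueTuples H fun _ : Fin q => W) := by
  have hzero : ∀ (α : Type) [Fintype α] [DecidableEq α] (G : SimpleGraph α) [DecidableRel G.Adj]
      (W : Finset α), (1 : ℝ) * (#W : ℝ) ^ 0 ≤ #(cliqueTuples G fun _ : Fin 0 => W) := by
    intro α _ _ G _ W
    have : (cliqueTuples G fun _ : Fin 0 => W).Nonempty :=
      ⟨fun a => a.elim0, mem_cliqueTuples.2 ⟨fun a => a.elim0, fun a => a.elim0⟩⟩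
    simpa using this.card_pos
  induction p generalizing q with
  | zero => exact ⟨1, one_pos, 0, fun α _ _ G H _ _ _ W _ => Or.inl (hzero α G W)⟩
  | succ p ihp =>
    induction q with
    | zero => exact ⟨1, one_pos, 0, fun α _ _ G H _ _ _ W _ => Or.inr (hzero α H W)⟩
    | succ q ihq =>
      obtain ⟨κ₁, hκ₁, n₁, h₁⟩ := ihp (q + 1)
      obtain ⟨κ₂, hκ₂, n₂, h₂⟩ := ihq
      refine ⟨min (κ₁ / (2 * 3 ^ (p + (q + 1)))) (κ₂ / (2 * 3 ^ (q + (p + 1)))), by positivity,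
        3 * (n₁ + n₂ + 1), fun α _ _ G H _ _ hGH W hW => ?_⟩
      have hdeg : ∀ v ∈ W, #W ≤ #{y ∈ W | G.Adj v y} + #{y ∈ W | H.Adj v y} + 1 := by
        intro v hv
        have hsub : W ⊆ ({y ∈ W | G.Adj v y} ∪ {y ∈ W | H.Adj v y}) ∪ {v} := by
          intro y hy
          by_cases hyv : y = v
          · simp [hyv]
          · rcases hGH v y (Ne.symm hyv) with h | h <;> simp [hy, h]
        refine (card_le_card hsub).trans ((card_union_le _ _).trans ?_)
        simpa using card_union_le _ _
      set A := {v ∈ W | #W ≤ 3 * #{y ∈ W | G.Adj v y}} with hA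
      rcases le_or_gt #W (2 * #A) with h | h
      · refine (erdosSzekeres_step hκ₁ (by omega) (filter_subset _ _) h
          (fun v hv => (mem_filter.1 hv).2) (h₁ α G H hGH)).imp ?_ ?_ <;>
        · refine le_trans ?_
          gcongr
          exact min_le_left _ _
      · have hB : #(W \ A) + #A = #W := card_sdiff_add_card_eq_card (filter_subset _ W)
        refine (erdosSzekeres_step (G := H) (H := G) hκ₂ (n := n₂) (A := W \ A) (by omega)
          sdiff_subset (by omega) (fun v hv => ?_) fun W' hW' =>
            (h₂ α G H hGH W' hW').symm).symm.imp ?_ ?_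
        · simp only [hA, mem_sdiff, mem_filter, not_and, not_le] at hv
          have h3 := hv.2 hv.1
          have h4 := hdeg v hv.1
          omega
        all_goals
          refine le_trans ?_
          gcongr
          exact min_le_right _ _

/-! ### Passing to the reduced coloring -/

section Partition

variable {α : Type} {G H : SimpleGraph α} [DecidableRel G.Adj] [DecidableRel H.Adj]

lemma edgeDensity_eq_one_sub (hGH : ∀ x y, x ≠ y → (H.Adj x y ↔ ¬ G.Adj x y)) {X Y : Finset α}
    (hX : X.Nonempty) (hY : Y.Nonempty) (hXY : Disjoint X Y) :
    (H.edgeDensity X Y : ℝ) = 1 - G.edgeDensity X Y := by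
  have hX' : (0 : ℝ) < #X := by exact_mod_cast hX.card_pos
  have hY' : (0 : ℝ) < #Y := by exact_mod_cast hY.card_pos
  have h1 := edgeDensity_mul_card (G := G) X Y
  have h2 := edgeDensity_mul_card (G := H) X Y
  have h3 : #(G.interedges X Y) + #(H.interedges X Y) = #X * #Y := by
    rw [SimpleGraph.interedges_def, SimpleGraph.interedges_def, ← card_product,
      ← card_filter_add_card_filter_not (s := X ×ˢ Y) (fun e => G.Adj e.1 e.2)]
    congr 2
    refine filter_congr fun e he => hGH _ _ fun h => ?_
    rw [mem_product] at he
    exact disjoint_left.1 hXY he.1 (h ▸ he.2)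
  have h4 : (#(G.interedges X Y) : ℝ) + #(H.interedges X Y) = #X * #Y := by exact_mod_cast h3
  have h5 : ((G.edgeDensity X Y : ℝ) + H.edgeDensity X Y - 1) * (#X * #Y) = 0 := by linarith
  have h6 := (mul_eq_zero.1 h5).resolve_right (by positivity)
  linarith

lemma isUniform_of_complementary (hGH : ∀ x y, x ≠ y → (H.Adj x y ↔ ¬ G.Adj x y)) {ε : ℝ}
    {U V : Finset α} (hU : U.Nonempty) (hV : V.Nonempty) (hUV : Disjoint U V)
    (h : G.IsUniform ε U V) : H.IsUniform ε U V := by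
  intro X hX Y hY hXc hYc
  have hε := h.pos
  have hU' : (0 : ℝ) < #U := by exact_mod_cast hU.card_pos
  have hV' : (0 : ℝ) < #V := by exact_mod_cast hV.card_pos
  have hX0 : X.Nonempty := card_pos.1 (by
    have : (0 : ℝ) < #X := lt_of_lt_of_le (by positivity) hXc
    exact_mod_cast this)
  have hY0 : Y.Nonempty := card_pos.1 (by
    have : (0 : ℝ) < #Y := lt_of_lt_of_le (by positivity) hYc
    exact_mod_cast this)
  have := h hX hY hXc hYc
  rw [edgeDensity_eq_one_sub hGH hX0 hY0 (disjoint_of_subset_left hX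
    (disjoint_of_subset_right hY hUV)), edgeDensity_eq_one_sub hGH hU hV hUV, abs_sub_comm]
  convert this using 2
  ring

/-- The excess of edges over non-edges between `X` and `Y`, halved. -/
noncomputable def discrepancy (G : SimpleGraph α) [DecidableRel G.Adj] (X Y : Finset α) : ℝ :=
  ∑ x ∈ X, ∑ y ∈ Y, ((if G.Adj x y then 1 else 0) - 1 / 2)

lemma discrepancy_eq (X Y : Finset α) :
    discrepancy G X Y = #(G.interedges X Y) - 1 / 2 * #X * #Y := by
  rw [card_interedges_eq_sum]
  simp only [discrepancy, sum_sub_distrib, sum_const, nsmul_eq_mul, card_filter]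
  push_cast
  ring

lemma abs_discrepancy_le (X Y : Finset α) : |discrepancy G X Y| ≤ 1 / 2 * (#X * #Y) := by
  rw [discrepancy]
  refine (abs_sum_le_sum_abs _ _).trans ?_
  calc ∑ x ∈ X, |∑ y ∈ Y, (((if G.Adj x y then 1 else 0) : ℝ) - 1 / 2)|
      ≤ ∑ _x ∈ X, ∑ _y ∈ Y, (1 / 2 : ℝ) := by
        refine sum_le_sum fun x _ => (abs_sum_le_sum_abs _ _).trans (sum_le_sum fun y _ => ?_)
        split_ifs <;> norm_num [abs_le]
    _ = _ := by simp only [sum_const, nsmul_eq_mul]; ring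

lemma abs_discrepancy_le_of_isUniform {ε : ℝ} {U V X Y : Finset α} (h : G.IsUniform ε U V)
    (hX : X ⊆ U) (hY : Y ⊆ V) :
    |discrepancy G X Y| ≤ (ε + |(G.edgeDensity U V : ℝ) - 1 / 2|) * (#U * #V) := by
  have hε := h.pos
  have hXU : (#X : ℝ) ≤ #U := by exact_mod_cast card_le_card hX
  have hYV : (#Y : ℝ) ≤ #V := by exact_mod_cast card_le_card hY
  have hX0 : (0 : ℝ) ≤ #X := by positivity
  have hY0 : (0 : ℝ) ≤ #Y := by positivity
  have habs := abs_nonneg ((G.edgeDensity U V : ℝ) - 1 / 2)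
  by_cases hXc : (#U : ℝ) * ε ≤ #X
  · by_cases hYc : (#V : ℝ) * ε ≤ #Y
    · have h1 := h hX hY hXc hYc
      have e : discrepancy G X Y = ((G.edgeDensity X Y : ℝ) - G.edgeDensity U V
          + (G.edgeDensity U V - 1 / 2)) * (#X * #Y) := by
        rw [discrepancy_eq, ← edgeDensity_mul_card]; ring
      rw [e, abs_mul, abs_of_nonneg (show (0 : ℝ) ≤ #X * #Y by positivity)]
      refine mul_le_mul ((abs_add_le _ _).trans (by linarith)) ?_ (by positivity) (by positivity)
      exact mul_le_mul hXU hYV hY0 (by positivity)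
    · push Not at hYc
      refine (abs_discrepancy_le X Y).trans ?_
      have h2 : (#X * #Y : ℝ) ≤ #U * (#V * ε) := mul_le_mul hXU hYc.le hY0 (by positivity)
      have h3 : 0 ≤ |(G.edgeDensity U V : ℝ) - 1 / 2| * (#U * #V) := by positivity
      nlinarith [show (0 : ℝ) ≤ #X * #Y by positivity]
  · push Not at hXc
    refine (abs_discrepancy_le X Y).trans ?_
    have h2 : (#X * #Y : ℝ) ≤ (#U * ε) * #V := mul_le_mul hXc.le hYV hY0 (by positivity)
    have h3 : 0 ≤ |(G.edgeDensity U V : ℝ) - 1 / 2| * (#U * #V) := by positivity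
    nlinarith [show (0 : ℝ) ≤ #X * #Y by positivity]

variable [DecidableEq α] {ι : Type} [Fintype ι] {V : ι → Finset α}

lemma sum_eq_sum_sum_inter (hdisj : ∀ i j, i ≠ j → Disjoint (V i) (V j))
    (hcover : ∀ x, ∃ i, x ∈ V i) (X : Finset α) (f : α → ℝ) :
    ∑ x ∈ X, f x = ∑ i, ∑ x ∈ X ∩ V i, f x := by
  rw [← sum_biUnion]
  · congr 1
    ext x
    simp only [mem_biUnion, mem_univ, true_and, mem_inter]
    exact ⟨fun h => (hcover x).imp fun i hi => ⟨h, hi⟩, fun ⟨i, h, _⟩ => h⟩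
  · intro i _ j _ hij
    exact disjoint_of_subset_left inter_subset_right
      (disjoint_of_subset_right inter_subset_right (hdisj i j hij))

variable [Fintype α]

lemma sum_card_parts (hdisj : ∀ i j, i ≠ j → Disjoint (V i) (V j))
    (hcover : ∀ x, ∃ i, x ∈ V i) : ∑ i, (#(V i) : ℝ) = Fintype.card α := by
  have := sum_eq_sum_sum_inter hdisj hcover univ fun _ => 1
  simpa using this.symm

/-- A double count of pairs of a tuple in `T` and a common neighbor: if only few tuples of `T` have
more than `t |α|` common neighbors, then the average product of the densities is not much more
than `t`. -/
lemma sum_prod_edgeDensity_le (hdisj : ∀ i j, i ≠ j → Disjoint (V i) (V j))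
    (hcover : ∀ x, ∃ i, x ∈ V i) {k : ℕ} {U : Fin k → Finset α} {J : Finset ι} {ε κ t r : ℝ}
    (hε : 0 ≤ ε) (hκ : 0 < κ) (ht : 0 ≤ t) (hU : ∀ j ∈ J, ∀ a, G.IsUniform ε (U a) (V j))
    {T : Finset (Fin k → α)} (hT : T ⊆ Fintype.piFinset U) (hT0 : T.Nonempty)
    (hTκ : κ * ∏ a, (#(U a) : ℝ) ≤ #T)
    (hrich : (#{x ∈ T | t * Fintype.card α ≤ #(commonNbrs G x univ)} : ℝ) ≤ r * #T) :
    ∑ j ∈ J, #(V j) / (Fintype.card α : ℝ) * ∏ a, (G.edgeDensity (U a) (V j) : ℝ)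
      ≤ t + r + (k * ε + k * ε / κ) := by
  set N := ((Fintype.card α : ℕ) : ℝ) with hN
  have hTpos : (0 : ℝ) < #T := by exact_mod_cast hT0.card_pos
  set Q := ∏ a, (#(U a) : ℝ) with hQ
  -- the sum over `J` of the lower bounds for the numbers of common neighbors
  have hlow : ∑ j ∈ J, (#T * ((∏ a, (G.edgeDensity (U a) (V j) : ℝ) - k * ε) * #(V j))
      - k * ε * Q * #(V j)) ≤ ∑ x ∈ T, (#(commonNbrs G x univ) : ℝ) := by
    refine (sum_le_sum fun j hj => le_sum_card_commonNbrs hε (hU j hj) hT).trans ?_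
    rw [sum_comm]
    refine sum_le_sum fun x _ => ?_
    rw [← Nat.cast_sum, ← card_biUnion]
    · refine Nat.cast_le.2 (card_le_card fun y hy => ?_)
      obtain ⟨j, -, hj⟩ := mem_biUnion.1 hy
      exact mem_commonNbrs.2 ⟨mem_univ y, (mem_commonNbrs.1 hj).2⟩
    · intro i _ j _ hij
      exact disjoint_of_subset_left (filter_subset _ _)
        (disjoint_of_subset_right (filter_subset _ _) (hdisj i j hij))
  have hN0 : 0 ≤ N := Nat.cast_nonneg _
  have hup : ∑ x ∈ T, (#(commonNbrs G x univ) : ℝ) ≤ #T * (t * N) + r * #T * N := by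
    have hpt : ∀ x ∈ T, (#(commonNbrs G x univ) : ℝ)
        ≤ t * N + if t * N ≤ #(commonNbrs G x univ) then N else 0 := by
      intro x _
      split_ifs with h
      · have : (#(commonNbrs G x univ) : ℝ) ≤ N := Nat.cast_le.2 (card_le_univ _)
        have h2 : 0 ≤ t * N := by positivity
        linarith
      · linarith
    refine (sum_le_sum hpt).trans ?_
    rw [sum_add_distrib, sum_const, nsmul_eq_mul, ← sum_filter, sum_const, nsmul_eq_mul]
    exact add_le_add_right (mul_le_mul_of_nonneg_right hrich hN0) _
  have hJ : ∑ j ∈ J, (#(V j) : ℝ) ≤ N := by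
    rw [hN, ← sum_card_parts hdisj hcover]
    exact sum_le_sum_of_subset_of_nonneg (subset_univ _) fun _ _ _ => Nat.cast_nonneg _
  rcases hN0.eq_or_lt with h0 | hNpos
  · have hr : 0 ≤ r := by
      have : 0 ≤ r * #T := le_trans (Nat.cast_nonneg _) hrich
      exact nonneg_of_mul_nonneg_left this hTpos
    simp only [← h0, div_zero, zero_mul, sum_const_zero]
    positivity
  have e : ∑ j ∈ J, (#T * ((∏ a, (G.edgeDensity (U a) (V j) : ℝ) - k * ε) * #(V j))
      - k * ε * Q * #(V j)) = #T * (∑ j ∈ J, #(V j) * ∏ a, (G.edgeDensity (U a) (V j) : ℝ))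
        - (#T * (k * ε) + k * ε * Q) * ∑ j ∈ J, (#(V j) : ℝ) := by
    rw [mul_sum, mul_sum, ← sum_sub_distrib]
    exact sum_congr rfl fun j _ => by ring
  rw [e] at hlow
  have hQT : Q ≤ #T / κ := by rw [le_div_iff₀ hκ]; linarith
  have hQ0 : 0 ≤ Q := prod_nonneg fun _ _ => Nat.cast_nonneg _
  have h1 : (#T * (k * ε) + k * ε * Q) * ∑ j ∈ J, (#(V j) : ℝ)
      ≤ (#T * (k * ε) + k * ε * (#T / κ)) * N := by
    have hkε : 0 ≤ k * ε := mul_nonneg (Nat.cast_nonneg k) hε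
    refine mul_le_mul (add_le_add le_rfl (mul_le_mul_of_nonneg_left hQT hkε)) hJ
      (sum_nonneg fun _ _ => Nat.cast_nonneg _) (add_nonneg (mul_nonneg hTpos.le hkε)
        (mul_nonneg hkε (div_nonneg hTpos.le hκ.le)))
  have h2 : #T * (∑ j ∈ J, #(V j) * ∏ a, (G.edgeDensity (U a) (V j) : ℝ))
      ≤ #T * ((t + r + (k * ε + k * ε / κ)) * N) := by
    have e3 : #T * ((t + r + (k * ε + k * ε / κ)) * N)
        = #T * (t * N) + r * #T * N + (#T * (k * ε) + k * ε * (#T / κ)) * N := by ring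
    rw [e3]
    linarith
  have h3 := le_of_mul_le_mul_left h2 hTpos
  rw [← div_le_iff₀ hNpos, sum_div] at h3
  refine le_trans (le_of_eq (sum_congr rfl fun j _ => ?_)) h3
  ring

/-- The coloring of the parts of a partition by the densities of `G` (color `1`) and of its
complement (color `0`), the parts being weighted by their relative sizes. -/
noncomputable def reducedColoring (G : SimpleGraph α) [DecidableRel G.Adj] (V : ι → Finset α)
    (hdisj : ∀ i j, i ≠ j → Disjoint (V i) (V j)) (hcover : ∀ x, ∃ i, x ∈ V i)
    (hα : 0 < Fintype.card α) : WeightedColoring ι where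
  w i := #(V i) / (Fintype.card α : ℝ)
  d c i j := if c = 1 then (G.edgeDensity (V i) (V j) : ℝ) else 1 - G.edgeDensity (V i) (V j)
  w_nonneg i := by positivity
  sum_w := by
    rw [← sum_div, sum_card_parts hdisj hcover, div_self (by exact_mod_cast hα.ne')]
  d_nonneg c i j := by
    have h0 : (0 : ℝ) ≤ G.edgeDensity (V i) (V j) := by exact_mod_cast G.edgeDensity_nonneg _ _
    have h1 : (G.edgeDensity (V i) (V j) : ℝ) ≤ 1 := by exact_mod_cast G.edgeDensity_le_one _ _
    split_ifs
    · exact h0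
    · linarith
  d_symm c i j := by rw [G.edgeDensity_comm]
  d_add c c' i j h := by
    fin_cases c <;> fin_cases c' <;> simp at h ⊢

open Classical in
/-- If most pairs of parts are uniform and the reduced coloring has densities close to `1/2` on
average, then `G` has small discrepancy between any two sets. -/
lemma abs_discrepancy_le_of_partition (hdisj : ∀ i j, i ≠ j → Disjoint (V i) (V j))
    (hcover : ∀ x, ∃ i, x ∈ V i) (hα : 0 < Fintype.card α) {ε η ξ : ℝ} (hε : 0 ≤ ε)
    {E : ι → ι → Prop} (hE : ∀ i j, ¬ E i j → G.IsUniform ε (V i) (V j))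
    (hEξ : ∑ i, (reducedColoring G V hdisj hcover hα).w i *
      (reducedColoring G V hdisj hcover hα).wt (E i) ≤ ξ)
    (hη : ∑ i, (reducedColoring G V hdisj hcover hα).w i *
      (reducedColoring G V hdisj hcover hα).dist i ≤ η) (X Y : Finset α) :
    |discrepancy G X Y| ≤ (ε + η + ξ) * (Fintype.card α : ℝ) ^ 2 := by
  set S := reducedColoring G V hdisj hcover hα with hS
  set N := ((Fintype.card α : ℕ) : ℝ) with hN
  have hN0 : 0 < N := by rw [hN]; exact_mod_cast hα
  have hw : ∀ i, (#(V i) : ℝ) = N * S.w i := fun i => by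
    change (#(V i) : ℝ) = N * (#(V i) / N)
    field_simp
  have e : discrepancy G X Y = ∑ i, ∑ j, discrepancy G (X ∩ V i) (Y ∩ V j) := by
    rw [discrepancy, sum_eq_sum_sum_inter hdisj hcover]
    refine sum_congr rfl fun i _ => ?_
    simp only [discrepancy]
    refine Eq.trans (sum_congr rfl fun x _ => ?_) sum_comm
    rw [sum_eq_sum_sum_inter hdisj hcover]
  have hpt : ∀ i j, |discrepancy G (X ∩ V i) (Y ∩ V j)| ≤
      N ^ 2 * (S.w i * (ε * S.w j + S.w j * |S.d 1 i j - 1 / 2| + if E i j then S.w j else 0)) := by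
    intro i j
    have hd : S.d 1 i j = (G.edgeDensity (V i) (V j) : ℝ) := by
      simp [hS, reducedColoring]
    have hwi := S.w_nonneg i
    have hwj := S.w_nonneg j
    have habs := abs_nonneg (S.d 1 i j - 1 / 2)
    split_ifs with hij
    · refine (abs_discrepancy_le _ _).trans ?_
      have h1 : (#(X ∩ V i) : ℝ) ≤ #(V i) := Nat.cast_le.2 (card_le_card inter_subset_right)
      have h2 : (#(Y ∩ V j) : ℝ) ≤ #(V j) := Nat.cast_le.2 (card_le_card inter_subset_right)
      have h3 : (#(X ∩ V i) * #(Y ∩ V j) : ℝ) ≤ #(V i) * #(V j) := by gcongr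
      rw [hw, hw] at h3
      have h4 : 0 ≤ N ^ 2 * (S.w i * (ε * S.w j + S.w j * |S.d 1 i j - 1 / 2|)) := by positivity
      have h5 : 0 ≤ N * S.w i * (N * S.w j) := by positivity
      nlinarith
    · refine (abs_discrepancy_le_of_isUniform (hE i j hij) inter_subset_right
        inter_subset_right).trans (le_of_eq ?_)
      rw [hw, hw, hd]
      ring
  rw [e]
  calc |∑ i, ∑ j, discrepancy G (X ∩ V i) (Y ∩ V j)|
      ≤ ∑ i, ∑ j, |discrepancy G (X ∩ V i) (Y ∩ V j)| :=
        (abs_sum_le_sum_abs _ _).trans (sum_le_sum fun i _ => abs_sum_le_sum_abs _ _)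
    _ ≤ ∑ i, ∑ j, N ^ 2 * (S.w i * (ε * S.w j + S.w j * |S.d 1 i j - 1 / 2|
          + if E i j then S.w j else 0)) :=
        sum_le_sum fun i _ => sum_le_sum fun j _ => hpt i j
    _ = N ^ 2 * (ε + ∑ i, S.w i * S.dist i + ∑ i, S.w i * S.wt (E i)) := by
        have e1 : ∀ i, ∑ j, N ^ 2 * (S.w i * (ε * S.w j + S.w j * |S.d 1 i j - 1 / 2|
            + if E i j then S.w j else 0))
            = N ^ 2 * (ε * S.w i + S.w i * S.dist i + S.w i * S.wt (E i)) := by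
          intro i
          rw [← mul_sum, ← mul_sum, sum_add_distrib, sum_add_distrib, ← mul_sum, S.sum_w]
          simp only [WeightedColoring.dist, WeightedColoring.wt]
          ring
        rw [sum_congr rfl fun i _ => e1 i, ← mul_sum, sum_add_distrib, sum_add_distrib, ← mul_sum,
          S.sum_w, mul_one]
    _ ≤ (ε + η + ξ) * N ^ 2 := by
        rw [mul_comm]
        refine mul_le_mul_of_nonneg_right ?_ (by positivity)
        have : ∑ i, S.w i * S.wt (E i) ≤ ξ := hEξ
        linarith

end Partition

open Classical in
/-- Szemerédi's regularity lemma, with the exceptional pairs measured by the sizes of the parts. -/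
lemma exists_uniform_partition {ε : ℝ} (hε : 0 < ε) :
    ∃ M : ℝ, 0 < M ∧ ∃ n : ℕ, ∀ (α : Type) [Fintype α] [DecidableEq α] (G : SimpleGraph α)
      [DecidableRel G.Adj], n ≤ Fintype.card α →
      ∃ (ι : Type) (_ : Fintype ι) (V : ι → Finset α), (∀ i j, i ≠ j → Disjoint (V i) (V j)) ∧
        (∀ x, ∃ i, x ∈ V i) ∧ (∀ i, (Fintype.card α : ℝ) ≤ M * #(V i)) ∧
        ∑ i, ∑ j, (if i = j ∨ ¬ G.IsUniform ε (V i) (V j) then (#(V i) * #(V j) : ℝ) else 0)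
          ≤ 8 * ε * (Fintype.card α : ℝ) ^ 2 := by
  set l := ⌈1 / ε⌉₊ + 1 with hl
  set b := SzemerediRegularity.bound ε l with hb
  have hb0 : 0 < b := SzemerediRegularity.bound_pos _ _
  refine ⟨2 * b, by positivity, l + 2 * b, fun α _ _ G _ hα => ?_⟩
  obtain ⟨P, hequi, hlP, hPb, hunif⟩ := szemeredi_regularity G hε
    (show l ≤ Fintype.card α by omega)
  set m := #P.parts with hm
  set N := ((Fintype.card α : ℕ) : ℝ) with hN
  have hm0 : 0 < m := by omega
  have hm0' : (0 : ℝ) < m := by exact_mod_cast hm0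
  have hNm : (2 * m : ℝ) ≤ N := by
    rw [hN]
    exact_mod_cast (by omega : 2 * m ≤ Fintype.card α)
  have hle : ∀ V ∈ P.parts, (#V : ℝ) ≤ 2 * N / m := fun V hV => by
    have h1 := hequi.card_part_le_average_add_one hV
    rw [card_univ] at h1
    have h2 : ((Fintype.card α / m : ℕ) : ℝ) ≤ N / m := Nat.cast_div_le
    have h3 : (#V : ℝ) ≤ (Fintype.card α / m : ℕ) + 1 := by exact_mod_cast h1
    have h4 : 1 ≤ N / m := by rw [le_div_iff₀ hm0']; linarith
    have : 2 * N / m = N / m + N / m := by ring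
    linarith
  have hge : ∀ V ∈ P.parts, N ≤ 2 * b * #V := fun V hV => by
    have h1 := hequi.average_le_card_part hV
    rw [card_univ, ← hm] at h1
    have h2 : Fintype.card α < m * (Fintype.card α / m + 1) := Nat.lt_mul_div_succ _ hm0
    have h3 : Fintype.card α ≤ m * (#V + 1) := h2.le.trans (Nat.mul_le_mul_left _ (by omega))
    have h4 : N ≤ m * (#V + 1) := by rw [hN]; exact_mod_cast h3
    have h5 : (m : ℝ) * #V ≤ b * #V := by gcongr
    linarith
  refine ⟨P.parts, inferInstance, fun i => i.1, fun i j hij => P.disjoint i.2 j.2 fun h =>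
    hij (Subtype.ext h), fun x => ?_, fun i => hge i.1 i.2, ?_⟩
  · obtain ⟨V, hV, hx⟩ := P.exists_mem (mem_univ x)
    exact ⟨⟨V, hV⟩, hx⟩
  have hcount : (#{p : P.parts × P.parts | p.1 = p.2 ∨ ¬ G.IsUniform ε p.1.1 p.2.1} : ℝ)
      ≤ 2 * ε * m ^ 2 := by
    have hsplit : #{p : P.parts × P.parts | p.1 = p.2 ∨ ¬ G.IsUniform ε p.1.1 p.2.1}
        ≤ m + #(P.nonUniforms G ε) := by
      have hsub : ({p : P.parts × P.parts | p.1 = p.2 ∨ ¬ G.IsUniform ε p.1.1 p.2.1} :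
          Finset (P.parts × P.parts))
          ⊆ ({p : P.parts × P.parts | p.1 = p.2} : Finset (P.parts × P.parts))
            ∪ ({p : P.parts × P.parts | p.1 ≠ p.2 ∧ ¬ G.IsUniform ε p.1.1 p.2.1} :
              Finset (P.parts × P.parts)) := by
        intro p hp
        simp only [mem_filter, mem_univ, true_and, mem_union] at hp ⊢
        tauto
      refine (card_le_card hsub).trans ((card_union_le _ _).trans (add_le_add ?_ ?_))
      · calc #{p : P.parts × P.parts | p.1 = p.2} ≤ #(univ : Finset P.parts) := by
              refine card_le_card_of_injOn (fun p => p.1) (fun _ _ => mem_univ _) ?_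
              intro p hp q hq hpq
              simp only [coe_filter, mem_univ, true_and, Set.mem_ofPred_eq] at hp hq hpq
              exact Prod.ext hpq (by rw [← hp, ← hq, hpq])
          _ = m := by simp [hm]
      · refine card_le_card_of_injOn (fun p => (p.1.1, p.2.1)) ?_ ?_
        · intro p hp
          simp only [coe_filter, mem_univ, true_and, Set.mem_ofPred_eq] at hp
          exact (P.mk_mem_nonUniforms G).2 ⟨p.1.2, p.2.2, fun h => hp.1 (Subtype.ext h), hp.2⟩
        · intro p _ q _ hpq
          exact Prod.ext (Subtype.ext (congrArg Prod.fst hpq)) (Subtype.ext (congrArg Prod.snd hpq))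
    have h1 : (#(P.nonUniforms G ε) : ℝ) ≤ (m * (m - 1) : ℕ) * ε := hunif
    have h2 : ((m * (m - 1) : ℕ) : ℝ) ≤ m ^ 2 := by
      exact_mod_cast (by rw [pow_two]; exact Nat.mul_le_mul_left _ (Nat.sub_le _ _))
    have h3 : 1 ≤ ε * m := by
      have h4 : 1 / ε ≤ m := (Nat.le_ceil _).trans (by exact_mod_cast (by omega : ⌈1 / ε⌉₊ ≤ m))
      rwa [div_le_iff₀ hε, mul_comm] at h4
    have h5 := (Nat.cast_le (α := ℝ)).2 hsplit
    rw [Nat.cast_add] at h5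
    nlinarith
  have h8 : (2 * N / m) ^ 2 * (2 * ε * m ^ 2) = 8 * ε * N ^ 2 := by field_simp; ring
  rw [← h8]
  refine le_trans ?_ (mul_le_mul_of_nonneg_left hcount (by positivity))
  rw [← sum_product', univ_product_univ]
  refine (sum_le_sum (g := fun p : P.parts × P.parts =>
    if p.1 = p.2 ∨ ¬ G.IsUniform ε p.1.1 p.2.1 then (2 * N / m) ^ 2 else 0) fun p _ => ?_).trans
      (le_of_eq ?_)
  · split_ifs
    · rw [pow_two]
      exact mul_le_mul (hle _ p.1.2) (hle _ p.2.2) (by positivity) (by positivity)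
    · exact le_rfl
  · rw [← sum_filter, sum_const, nsmul_eq_mul, mul_comm]

/-! ### Rich cliques and the conclusion -/

lemma image_mem_richCliques {N : ℕ} (C : Coloring N) (c : Fin 2) {k : ℕ} {t : ℝ}
    {x : Fin k → Fin N} (hx : ∀ a b, a ≠ b → (C.labelGraph c).Adj (x a) (x b))
    (ht : t ≤ #(commonNbrs (C.labelGraph c) x univ)) : univ.image x ∈ C.richCliques k t := by
  have hinj : Function.Injective x := fun a b hab => by
    by_contra hne
    exact (hx a b hne).ne hab
  have hcl : (C.labelGraph c).IsNClique k (univ.image x) := by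
    refine ⟨?_, by rw [card_image_of_injective _ hinj, card_univ, Fintype.card_fin]⟩
    intro u hu v hv huv
    simp only [coe_image, coe_univ, Set.image_univ, Set.mem_range] at hu hv
    obtain ⟨a, rfl⟩ := hu
    obtain ⟨b, rfl⟩ := hv
    exact hx a b fun h => huv (by rw [h])
  simp only [Coloring.richCliques, mem_filter, mem_univ, true_and]
  refine ⟨⟨c, hcl⟩, ht.trans (Nat.cast_le.2 (card_le_card fun y hy => ?_))⟩
  have hy' := (mem_commonNbrs.1 hy).2
  simp only [Coloring.extensions, mem_filter, mem_univ, true_and]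
  refine ⟨?_, c, hcl.insert ?_⟩
  · intro hmem
    obtain ⟨a, -, rfl⟩ := mem_image.1 hmem
    exact (hy' a).ne rfl
  · intro v hv
    obtain ⟨a, -, rfl⟩ := mem_image.1 hv
    exact (hy' a).symm

/-- A rich clique comes from at most `k ^ k` tuples. -/
lemma card_rich_tuples_le {N : ℕ} (C : Coloring N) (c : Fin 2) {k : ℕ} {t : ℝ}
    {T : Finset (Fin k → Fin N)}
    (hT : ∀ x ∈ T, ∀ a b, a ≠ b → (C.labelGraph c).Adj (x a) (x b)) :
    #{x ∈ T | t ≤ #(commonNbrs (C.labelGraph c) x univ)} ≤ k ^ k * #(C.richCliques k t) := by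
  set A := {x ∈ T | t ≤ #(commonNbrs (C.labelGraph c) x univ)} with hA
  refine (card_le_mul_card_image (f := fun x => univ.image x) A (k ^ k) fun Q hQ => ?_).trans
    (Nat.mul_le_mul_left _ (card_le_card fun Q hQ => ?_))
  · obtain ⟨z, hz, rfl⟩ := mem_image.1 hQ
    calc #{x ∈ A | univ.image x = univ.image z}
        ≤ #(Fintype.piFinset fun _ : Fin k => univ.image z) := by
          refine card_le_card fun x hx => Fintype.mem_piFinset.2 fun a => ?_
          rw [← (mem_filter.1 hx).2]
          exact mem_image_of_mem x (mem_univ a)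
      _ ≤ k ^ k := by
          rw [Fintype.card_piFinset_const]
          refine Nat.pow_le_pow_left ?_ _
          simpa using card_image_le (s := (univ : Finset (Fin k))) (f := z)
  · obtain ⟨z, hz, rfl⟩ := mem_image.1 hQ
    exact image_mem_richCliques C c (hT z (mem_filter.1 hz).1) (mem_filter.1 hz).2

lemma labelGraph_adj_iff_not {N : ℕ} (C : Coloring N) {c c' : Fin 2} (hc : c ≠ c')
    (x y : Fin N) (hxy : x ≠ y) : (C.labelGraph c').Adj x y ↔ ¬ (C.labelGraph c).Adj x y := by
  simp only [SimpleGraph.TopEdgeLabeling.labelGraph_adj, hxy, ne_eq, not_false_eq_true,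
    exists_true_left]
  generalize C.get x y hxy = e
  omega

end BookRegularity

open BookRegularity in
theorem theorem1p4 (k : ℕ) (hk : 2 ≤ k) (θ : ℝ) (hθ0 : 0 < θ) (hθ : θ < 1 / 2) :
    ∃ c₁ : ℝ, 0 < c₁ ∧ ∃ N₀ : ℕ, ∀ N : ℕ, N₀ ≤ N → ∀ C : Coloring N,
      ¬ C.IsQuasirandom θ →
        c₁ * (N : ℝ) ^ k ≤ ((C.richCliques k ((((2 : ℝ) ^ k)⁻¹ + c₁) * N)).card : ℝ) := by
  obtain ⟨δ, hδ, ζ, hζ, hreduced⟩ :=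
    WeightedColoring.IsBookBounded.sum_dist_le hk (half_pos hθ0)
  obtain ⟨κ₁, hκ₁, nR, hramsey⟩ := exists_le_card_cliqueTuples_or k k
  obtain ⟨κ₂, hκ₂, ε₀, hε₀, hcount⟩ := exists_le_card_cliqueTuples k hδ
  obtain ⟨κ, hκ, hκκ₁, hκκ₂⟩ : ∃ κ > 0, κ ≤ κ₁ ∧ κ ≤ κ₂ :=
    ⟨min κ₁ κ₂, by positivity, min_le_left _ _, min_le_right _ _⟩
  have hk0 : (0 : ℝ) < k := by exact_mod_cast (by omega : 0 < k)
  have hk1 : (1 : ℝ) ≤ k := by exact_mod_cast (by omega : 1 ≤ k)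
  -- a part is typical if its exceptional pairs have weight at most `ζ'`; of the error `ζ`, one
  -- quarter each is for these pairs, for the counting of extensions, and for the rich cliques
  set ζ' := ζ / (4 * k) with hζ'
  have hζ'0 : 0 < ζ' := by positivity
  have hkζ' : k * ζ' = ζ / 4 := by rw [hζ']; field_simp
  have hζ'ζ : ζ' ≤ ζ := by nlinarith
  obtain ⟨ε, hε, hεε₀, hεk, hεζ, hεθ⟩ : ∃ ε > 0, ε ≤ ε₀ ∧ ε ≤ ζ / (4 * (k + k / κ)) ∧
      ε ≤ ζ * ζ' / 8 ∧ ε ≤ θ / 18 := by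
    refine ⟨min ε₀ (min (ζ / (4 * (k + k / κ))) (min (ζ * ζ' / 8) (θ / 18))), by positivity,
      ?_, ?_, ?_, ?_⟩ <;> simp
  rw [le_div_iff₀ (by positivity)] at hεk
  obtain ⟨M, hM, nS, hpartition⟩ := exists_uniform_partition hε
  set c₁ := ζ / 4 / (1 + k ^ k * M ^ k / κ) with hc₁
  have hc₁0 : 0 < c₁ := by positivity
  have hc₁ζ : c₁ + k ^ k * c₁ * M ^ k / κ = ζ / 4 := by
    rw [hc₁]; field_simp
  refine ⟨c₁, hc₁0, nS + ⌈nR * M⌉₊ + 1, fun N hN C hC => ?_⟩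
  by_contra hfew
  push Not at hfew
  refine hC ?_
  have hN0 : (0 : ℝ) < N := by exact_mod_cast (by omega : 0 < N)
  have hNR : (nR * M : ℝ) ≤ N :=
    (Nat.le_ceil _).trans (by exact_mod_cast (by omega : ⌈nR * M⌉₊ ≤ N))
  obtain ⟨ι, _, V, hdisj, hcover, hVM, hexc⟩ := hpartition (Fin N) C.blue
    (by rw [Fintype.card_fin]; omega)
  have hcard : (Fintype.card (Fin N) : ℝ) = N := by rw [Fintype.card_fin]
  rw [hcard] at hexc hVM
  have hVpos : ∀ i, 0 < #(V i) := fun i => by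
    have h1 := hVM i
    by_contra h0
    rw [Nat.eq_zero_of_not_pos h0] at h1
    simp at h1
    linarith
  have hVne : ∀ i, (V i).Nonempty := fun i => card_pos.1 (hVpos i)
  have hVR : ∀ i, nR ≤ #(V i) := fun i => by
    have : (nR * M : ℝ) ≤ M * #(V i) := hNR.trans (hVM i)
    exact_mod_cast (le_of_mul_le_mul_right (by linarith) hM : (nR : ℝ) ≤ #(V i))
  have hα : 0 < Fintype.card (Fin N) := by rw [Fintype.card_fin]; omega
  set S := reducedColoring C.blue V hdisj hcover hα with hS
  set E : ι → ι → Prop := fun i j => i = j ∨ ¬ C.blue.IsUniform ε (V i) (V j) with hE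
  have hEsymm : ∀ i j, E i j → E j i := fun i j h =>
    h.imp Eq.symm fun h h' => h h'.symm
  -- densities and uniformity for both colors
  have hunif : ∀ c i j, ¬ E i j → (C.labelGraph c).IsUniform ε (V i) (V j) := by
    intro c i j hij
    simp only [hE, not_or, not_not] at hij
    by_cases hc : c = 1
    · rw [hc]; exact hij.2
    · exact isUniform_of_complementary (labelGraph_adj_iff_not C (Ne.symm hc)) (hVne i) (hVne j)
        (hdisj i j hij.1) hij.2
  have hdens : ∀ c i j, ¬ E i j → S.d c i j = (C.labelGraph c).edgeDensity (V i) (V j) := by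
    intro c i j hij
    simp only [hE, not_or, not_not] at hij
    by_cases hc : c = 1
    · subst hc; simp [hS, reducedColoring]
    · rw [edgeDensity_eq_one_sub (labelGraph_adj_iff_not C (Ne.symm hc)) (hVne i) (hVne j)
        (hdisj i j hij.1)]
      simp [hS, reducedColoring, hc]
  have hw : ∀ i, S.w i = #(V i) / (N : ℝ) := fun i => by rw [← hcard]; rfl
  have hEwt : ∑ i, S.w i * S.wt (E i) ≤ 8 * ε := by
    have e : ∑ i, S.w i * S.wt (E i) = (∑ i, ∑ j, @ite ℝ (i = j ∨ ¬ C.blue.IsUniform ε (V i) (V j))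
        (Classical.propDecidable _) (#(V i) * #(V j) : ℝ) 0) / (N : ℝ) ^ 2 := by
      rw [sum_div]
      refine sum_congr rfl fun i _ => ?_
      rw [WeightedColoring.wt, mul_sum, sum_div]
      refine sum_congr rfl fun j _ => ?_
      rw [hw, hw]
      by_cases h : E i j
      · rw [if_pos h, if_pos h]; field_simp
      · rw [if_neg h, if_neg h]; simp
    rw [e, div_le_iff₀ (by positivity)]
    refine le_trans (le_of_eq (sum_congr rfl fun i _ => sum_congr rfl fun j _ => ?_)) hexc
    congr
  set T : ι → Prop := fun i => S.wt (E i) ≤ ζ' with hT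
  -- the double count of extensions, for typical parts with a positive proportion of cliques; since
  -- `N ≤ M * #(V i)`, the few rich tuples are also few relative to the number of these cliques
  have hbook : ∀ (c : Fin 2) (U : Fin k → ι), (∀ a, T (U a)) →
      κ * ∏ a, (#(V (U a)) : ℝ) ≤ #(cliqueTuples (C.labelGraph c) fun a => V (U a)) →
      ∑ j, S.w j * ∏ a, S.d c (U a) j ≤ (1 / 2) ^ k + ζ := by
    intro c U hU hcl
    classical
    set t : ℝ := ((2 : ℝ) ^ k)⁻¹ + c₁ with ht
    set Tc := cliqueTuples (C.labelGraph c) fun a => V (U a) with hTc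
    have hprodpos : 0 < ∏ a, (#(V (U a)) : ℝ) :=
      prod_pos fun a _ => by exact_mod_cast hVpos _
    have hTcpos : (0 : ℝ) < #Tc := lt_of_lt_of_le (by positivity) hcl
    have hNk : (N : ℝ) ^ k ≤ M ^ k * (#Tc / κ) := by
      calc (N : ℝ) ^ k = ∏ _a : Fin k, (N : ℝ) := by simp
        _ ≤ ∏ a, (M * #(V (U a)) : ℝ) := prod_le_prod (fun _ _ => hN0.le) fun a _ => hVM _
        _ = M ^ k * ∏ a, (#(V (U a)) : ℝ) := by rw [prod_mul_distrib]; simp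
        _ ≤ M ^ k * (#Tc / κ) := by
          refine mul_le_mul_of_nonneg_left ?_ (by positivity)
          rw [le_div_iff₀ hκ]; linarith
    have hrich : (#{x ∈ Tc | t * Fintype.card (Fin N)
        ≤ #(commonNbrs (C.labelGraph c) x univ)} : ℝ) ≤ (k ^ k * c₁ * M ^ k / κ) * #Tc := by
      rw [hcard]
      have h1 := card_rich_tuples_le C c (T := Tc) (t := t * N) fun x hx =>
        (mem_cliqueTuples.1 hx).2
      have h2 : (_ : ℝ) ≤ ((k ^ k * #(C.richCliques k (t * N)) : ℕ) : ℝ) := Nat.cast_le.2 h1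
      refine h2.trans ?_
      push_cast
      calc (k : ℝ) ^ k * #(C.richCliques k (t * N)) ≤ k ^ k * (c₁ * N ^ k) := by gcongr
        _ ≤ k ^ k * (c₁ * (M ^ k * (#Tc / κ))) := by gcongr
        _ = _ := by ring
    have hsum := sum_prod_edgeDensity_le (G := C.labelGraph c) hdisj hcover
      (J := {j | ∀ a, ¬ E (U a) j}) hε.le hκ (by positivity : 0 ≤ t)
      (fun j hj a => hunif c _ _ ((mem_filter.1 hj).2 a)) (cliqueTuples_subset _)
      (card_pos.1 (by exact_mod_cast hTcpos)) hcl hrich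
    have hrest : S.wt (fun j => ∃ a, E (U a) j) ≤ k * ζ' := S.wt_exists_le fun a => hU a
    have hsplit : ∑ j, S.w j * ∏ a, S.d c (U a) j
        ≤ ∑ j ∈ {j | ∀ a, ¬ E (U a) j}, #(V j) / (Fintype.card (Fin N) : ℝ) *
          ∏ a, ((C.labelGraph c).edgeDensity (V (U a)) (V j) : ℝ)
          + S.wt (fun j => ∃ a, E (U a) j) := by
      rw [sum_filter, WeightedColoring.wt, ← sum_add_distrib]
      refine sum_le_sum fun j _ => ?_
      by_cases hj : ∀ a, ¬ E (U a) j
      · rw [if_pos hj, if_neg (by push Not; exact hj), add_zero, hw, hcard,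
          prod_congr rfl fun a _ => hdens c (U a) j (hj a)]
      · rw [if_neg hj, if_pos (by push Not at hj; exact hj), zero_add]
        exact mul_le_of_le_one_right (S.w_nonneg j) (prod_le_one (fun a _ => S.d_nonneg _ _ _)
          fun a _ => S.d_le_one _ _ _)
    have ht' : t = (1 / 2) ^ k + c₁ := by rw [ht, one_div, inv_pow]
    have hkε : k * ε + k * ε / κ ≤ ζ / 4 := by
      have : k * ε + k * ε / κ = ε * (4 * (k + k / κ)) / 4 := by ring
      rw [this]; linarith
    linarith
  -- each part is rich in cliques of some color
  have hcol : ∀ i, ∃ c, κ * (#(V i) : ℝ) ^ k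
      ≤ #(cliqueTuples (C.labelGraph c) fun _ : Fin k => V i) := by
    intro i
    have h01 : ∀ x y, x ≠ y → (C.labelGraph 0).Adj x y ∨ (C.labelGraph 1).Adj x y := by
      intro x y hxy
      have := labelGraph_adj_iff_not C (show (0 : Fin 2) ≠ 1 by decide) x y hxy
      tauto
    have hle : κ * (#(V i) : ℝ) ^ k ≤ κ₁ * (#(V i) : ℝ) ^ k := by gcongr
    rcases hramsey (Fin N) (C.labelGraph 0) (C.labelGraph 1) h01 (V i) (hVR i) with h | h
    · exact ⟨0, hle.trans h⟩
    · exact ⟨1, hle.trans h⟩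
  choose col hcol using hcol
  have hS' : S.IsBookBounded k δ ζ E T col := by
    refine ⟨hEsymm, fun i hi => le_trans hi hζ'ζ, ?_, fun i hi => ?_, fun c x hxT hxE hxd => ?_⟩
    · have h1 := S.mul_wt_le (P := fun i => ¬ T i) (f := fun i => S.wt (E i))
        (fun i => S.wt_nonneg _) (t := ζ') fun i hi => (not_le.1 hi).le
      have h2 : ζ' * S.wt (fun i => ¬ T i) ≤ ζ' * ζ := by linarith
      exact le_of_mul_le_mul_left h2 hζ'0
    · simpa using hbook (col i) (fun _ => i) (fun _ => hi) (by simpa using hcol i)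
    · refine hbook c x hxT (le_trans ?_ (hcount (Fin N) (C.labelGraph c) ε (fun a => V (x a))
        hε.le hεε₀ (fun a b hab => hunif c _ _ (hxE a b hab)) fun a b hab => ?_))
      · exact mul_le_mul_of_nonneg_right hκκ₂ (prod_nonneg fun _ _ => Nat.cast_nonneg _)
      · rw [← hdens c _ _ (hxE a b hab)]; exact hxd a b hab
  have hη := hreduced ι S E T col hS'
  intro X Y _
  have hfinal := abs_discrepancy_le_of_partition hdisj hcover hα hε.le
    (fun i j hij => hunif 1 i j hij) hEwt hη X Y
  rw [discrepancy_eq, hcard] at hfinal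
  exact hfinal.trans (mul_le_mul_of_nonneg_right (by linarith) (by positivity))
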